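/- Let $k\ge 3$ be an integer and let $f$ be an orientation preserving diffeomorphism of the circle $\mathbb T=\mathbb R/\mathbb Z$ of class $C^k$ (that is, $f$ and $f^{-1}$ are of class $C^k$) with irrational rotation number. Let $F:\mathbb R\to\mathbb R$ be a lift of $f$, let $\alpha=\lim_{n\to\infty}\frac{F^n(x)-x}{n}$ be its rotation number, let $p_n/q_n$ $(n\ge 0)$ be the convergents (in lowest terms) of the continued fraction expansion of $\alpha$, and let $\alpha_n=|q_n\alpha-p_n|$. For $x\in\mathbb T$ let $I_n(x)$ be the open interval with endpoints $x$ and $f^{q_n}(x)$, whose lift to $\mathbb R$ is the open interval between $x$ and $F^{q_n}(x)-p_n$; let $\beta_n(x)=|I_n(x)|$ be its length, and let $$M_n=\max_{x\in\mathbb T}\beta_n(x),\qquad m_n=\min_{x\in\mathbb T}\beta_n(x).$$ Then there is a constant $C>0$, depending on $f$ and $k$ but not on $n$, such that $CM_n^{1/2}<1$ for all sufficiently large $n$, such that for every $n\ge 0$ with $CM_n^{1/2}<1$ $$M_{n+1}\le M_n\,\frac{\frac{\alpha_{n+1}}{\alpha_n}+C\,M_n^{(k-1)/2}}{1-C\,M_n^{1/2}},$$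 and such that for every $n\ge 0$ $$m_{n+1}\ge m_n\,\frac{\frac{\alpha_{n+1}}{\alpha_n}-C\,M_n^{(k-1)/2}}{1+C\,M_n^{1/2}}.$$ -/

import Mathlib

open Set Filter MeasureTheory

/-!
Orientation preserving circle homeomorphisms are handled through their lifts
`F : ℝ → ℝ` (`CircleDeg1Lift`: monotone maps with `F (x + 1) = F x + 1`; the invertible ones,
`CircleDeg1Liftˣ`, are the orientation preserving homeomorphisms of `ℝ` commuting with `x ↦ x + 1`).
The rotation number of a lift is Mathlib's `CircleDeg1Lift.translationNumber`, the limit of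
`(F^[n] x - x) / n`. Replacing `F` by the lift `F + j`, `j ∈ ℤ`, replaces the rotation number `α` by
`α + j` and leaves all the quantities `α_n`, `β_n`, `M_n`, `m_n` below unchanged.
-/

namespace CircleDynamics

noncomputable section

/-- The denominator `q_n` of the `n`-th convergent `p_n / q_n` (in lowest terms) of the continued
fraction expansion of `α`. -/
def q (α : ℝ) (n : ℕ) : ℕ := (α.convergent n).den

/-- The numerator `p_n` of the `n`-th convergent `p_n / q_n` (in lowest terms) of the continued
fraction expansion of `α`. -/
def p (α : ℝ) (n : ℕ) : ℤ := (α.convergent n).num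

/-- `α_n = |q_n α - p_n|`. -/
def alphaSeq (α : ℝ) (n : ℕ) : ℝ := |(q α n : ℝ) * α - (p α n : ℝ)|

/-- The interval `I_n(x)` with endpoints `x` and `f^{q_n}(x)`, lifted to `ℝ`: it is the open interval
between `x` and `F^{q_n}(x) - p_n`, where `p_n / q_n` are the convergents of the rotation number of
the lift `F`. When the rotation number is irrational, the second endpoint is on the right
of `x` for `n` even and on the left of `x` for `n` odd. -/
def interval (F : CircleDeg1Lift) (n : ℕ) (x : ℝ) : Set ℝ :=
  uIoo x (F^[q F.translationNumber n] x - (p F.translationNumber n : ℝ))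

/-- `β_n(x) = |I_n(x)|`, the length of `I_n(x)`. It is a `1`-periodic function of `x`. -/
def beta (F : CircleDeg1Lift) (n : ℕ) (x : ℝ) : ℝ := volume.real (interval F n x)

/-- `M_n`, the maximum of `β_n` (over the circle, or equivalently over `ℝ`, by periodicity). -/
def bigM (F : CircleDeg1Lift) (n : ℕ) : ℝ := ⨆ x : ℝ, beta F n x

/-- `m_n`, the minimum of `β_n` (over the circle, or equivalently over `ℝ`, by periodicity). -/
def smallM (F : CircleDeg1Lift) (n : ℕ) : ℝ := ⨅ x : ℝ, beta F n x

end

end CircleDynamics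

/-!
Write `g_n = f^{q_n}` for the return maps (`ret` is the lift of `g_n` that moves points the least),
so that `β_n = |g_n - id|`. The theorem follows from two facts about `β_{n+1}` on the interval
`J = [x, g_n²(x)]`.

*Mean value identity* (`exists_alphaSeq_mul_beta_eq`). A monotone map `K` semiconjugates the rotation
to `f`. The integrals of `K (s + α_{n+1}) - K s` over an interval of length `α_n` and of
`K (s + α_n) - K s` over one of length `α_{n+1}` agree, up to signs. Hence
`α_n β_{n+1}(y) = α_{n+1} β_n(z)` for some `y ∈ J` and some `z` near `x`; no regularity of the
conjugacy is needed.

*Small variation* (`exists_abs_beta_succ_sub_le`). On `J` the function `β_{n+1}` varies by at most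
`C (M_n^{(k-1)/2} β_n(x) + M_n^{1/2} β_{n+1}(x))`. Taking for `x` a maximum or a minimum of `β_{n+1}`
and combining the two facts gives both inequalities.

The small variation rests on bounds for the derivatives of `f^l`, `l ≤ 2 q_{n+1}`, at the scale
`M_n^{1/2} / β_n(x)`.

* The intervals `f^i(I_n(x))`, `0 ≤ i < q_{n+1}`, are disjoint on the circle (`sum_orbit_intervals_le`,
  from the law of best approximation and the fact that orbits are ordered as for the rotation). This
  gives Denjoy's distortion bounds, `M_n → 0` (`tendsto_bigM`), and the bound `C M_n / β_n(x)²` for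
  the Schwarzian derivative of `f^l` (`exists_abs_schwarzian_le`).
* Near a point, `g_n` is close to a Möbius transformation, and the trace of that transformation,
  `jetTrace`, is almost invariant under `f`: it changes by `O(β_n²)` at each step. At a minimum of
  `β_n` it is at most `2`, hence it is at most `2 + C M_n` everywhere (`exists_jetTrace_le`). At an
  extremum of `log g_n'` it equals `2 cosh (log g_n' / 2)`, and therefore `|log g_n'| ≤ C M_n^{1/2}`
  (`exists_abs_logDIter_q_le_sqrt`).
* At an extremum of `β_n · (log (f^l)')'` the last bound and the Schwarzian bound yield
  `|(log (f^l)')'| ≤ C M_n^{1/2} / β_n` (`exists_abs_deriv_logDIter_le_sqrt`). Differentiating the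
  chain rule of the Schwarzian derivative gives the higher derivatives by induction
  (`exists_abs_iteratedDeriv_logDIter_le`), in particular
  `|D^k g_{n+1}| ≤ C (M_n^{1/2} / β_n)^{k-1}`.
* Since `g_n` commutes with `g_{n+1}` and has derivative `1 + O(M_n^{1/2})`, the displacement of
  `g_{n+1}` is constant up to `O(M_n^{1/2} β_{n+1}(x))` at the `k` points `g_n^i(x)`, `0 ≤ i < k`.
  Interpolation at these points, with the bound on the derivative of order `k`, controls it on `J`
  (`abs_sub_le_of_nodes`).
-/

namespace CircleDynamics

/-! ### Convergents of an irrational number -/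

/-- The signed quantity `q_n α - p_n`, whose absolute value is `α_n`. -/
noncomputable def delta (α : ℝ) (n : ℕ) : ℝ := (q α n : ℝ) * α - (p α n : ℝ)

theorem alphaSeq_eq_abs_delta (α : ℝ) (n : ℕ) : alphaSeq α n = |delta α n| := rfl

theorem q_pos (α : ℝ) (n : ℕ) : 0 < q α n := Rat.den_pos _

theorem fract_pos_of_irrational {α : ℝ} (hα : Irrational α) : 0 < Int.fract α :=
  Int.fract_pos.2 (hα.ne_int _)

theorem irrational_inv_fract {α : ℝ} (hα : Irrational α) : Irrational (Int.fract α)⁻¹ := by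
  rw [irrational_inv_iff, Int.fract]
  exact hα.sub_intCast _

theorem one_lt_inv_fract {α : ℝ} (hα : Irrational α) : 1 < (Int.fract α)⁻¹ :=
  (one_lt_inv₀ (fract_pos_of_irrational hα)).2 (Int.fract_lt_one α)

theorem convergent_pos (n : ℕ) : ∀ {α : ℝ}, Irrational α → 1 < α → 0 < α.convergent n := by
  induction n with
  | zero =>
    intro α _ h
    rw [Real.convergent_zero]
    exact_mod_cast Int.floor_pos.2 h.le
  | succ n ih =>
    intro α hα h
    rw [Real.convergent_succ]
    have h1 : (0 : ℚ) < ⌊α⌋ := by exact_mod_cast Int.floor_pos.2 h.le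
    have h2 := ih (irrational_inv_fract hα) (one_lt_inv_fract hα)
    positivity

theorem p_pos {α : ℝ} (hα : Irrational α) (h : 1 < α) (n : ℕ) : 0 < p α n :=
  Rat.num_pos.2 (convergent_pos n hα h)

theorem q_zero (α : ℝ) : q α 0 = 1 := by simp [q]

theorem p_zero (α : ℝ) : p α 0 = ⌊α⌋ := by simp [p]

theorem q_succ {α : ℝ} (hα : Irrational α) (n : ℕ) :
    (q α (n + 1) : ℤ) = p (Int.fract α)⁻¹ n := by
  have hp := p_pos (irrational_inv_fract hα) (one_lt_inv_fract hα) n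
  have h : (Int.fract α)⁻¹.convergent n ≠ 0 :=
    (convergent_pos n (irrational_inv_fract hα) (one_lt_inv_fract hα)).ne'
  rw [q, Real.convergent_succ, Rat.intCast_add_den, Rat.den_inv_of_ne_zero h]
  exact Int.natAbs_of_nonneg hp.le

theorem p_succ {α : ℝ} (hα : Irrational α) (n : ℕ) :
    p α (n + 1) = ⌊α⌋ * p (Int.fract α)⁻¹ n + q (Int.fract α)⁻¹ n := by
  have hpos := convergent_pos n (irrational_inv_fract hα) (one_lt_inv_fract hα)
  have hq := q_succ hα n
  have h1 : ((p α (n + 1) : ℤ) : ℚ) = α.convergent (n + 1) * (q α (n + 1) : ℤ) := by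
    rw [p, q]; exact (Rat.mul_den_eq_num _).symm
  have h2 : ((p (Int.fract α)⁻¹ n : ℤ) : ℚ) =
      (Int.fract α)⁻¹.convergent n * (q (Int.fract α)⁻¹ n : ℤ) := by
    rw [p, q]; exact (Rat.mul_den_eq_num _).symm
  have h3 : ((p α (n + 1) : ℤ) : ℚ) =
      ((⌊α⌋ * p (Int.fract α)⁻¹ n + q (Int.fract α)⁻¹ n : ℤ) : ℚ) := by
    rw [h1, hq, Real.convergent_succ]
    push_cast
    rw [h2]
    generalize (Int.fract α)⁻¹.convergent n = r at hpos
    have hr := hpos.ne'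
    push_cast
    field_simp
  exact_mod_cast h3

theorem delta_zero (α : ℝ) : delta α 0 = Int.fract α := by
  simp [delta, q_zero, p_zero]

theorem delta_succ {α : ℝ} (hα : Irrational α) (n : ℕ) :
    delta α (n + 1) = -(Int.fract α * delta (Int.fract α)⁻¹ n) := by
  have h0 := fract_pos_of_irrational hα
  have hq : (q α (n + 1) : ℝ) = (p (Int.fract α)⁻¹ n : ℝ) := by exact_mod_cast q_succ hα n
  rw [delta, delta, hq, p_succ hα]
  push_cast
  have h1 : α = ⌊α⌋ + Int.fract α := (Int.floor_add_fract α).symm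
  have h2 : Int.fract α * (Int.fract α)⁻¹ = 1 := mul_inv_cancel₀ h0.ne'
  linear_combination (p (Int.fract α)⁻¹ n : ℝ) * h1 + (q (Int.fract α)⁻¹ n : ℝ) * h2

/-- `q_n α - p_n` has the sign of `(-1)^n`. -/
theorem delta_sign (n : ℕ) : ∀ {α : ℝ}, Irrational α → 0 < (-1) ^ n * delta α n := by
  induction n with
  | zero => intro α hα; simpa [delta_zero] using fract_pos_of_irrational hα
  | succ n ih =>
    intro α hα
    rw [delta_succ hα, pow_succ]
    have := mul_pos (fract_pos_of_irrational hα) (ih (irrational_inv_fract hα))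
    linarith

theorem abs_delta_pos {α : ℝ} (hα : Irrational α) (n : ℕ) : 0 < |delta α n| := by
  rw [abs_pos]
  rintro h
  have := delta_sign n hα
  simp [h] at this

/-- This is `α_n = a_{n+2} α_{n+1} + α_{n+2}` with `a_{n+2} ≥ 1`, proved by induction through the
Gauss map, as are the other facts on convergents. -/
theorem abs_delta_add_le (n : ℕ) : ∀ {α : ℝ}, Irrational α →
    |delta α (n + 1)| + |delta α (n + 2)| ≤ |delta α n| := by
  induction n with
  | zero =>
    intro α hα
    have hα' := irrational_inv_fract hα
    have h0 := fract_pos_of_irrational hα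
    have h1 := fract_pos_of_irrational hα'
    have h2 := fract_pos_of_irrational (irrational_inv_fract hα')
    have h3 := (irrational_inv_fract hα')
    rw [delta_succ hα, delta_succ hα, delta_succ hα', delta_zero, delta_zero, delta_zero,
      abs_neg, abs_neg, abs_mul, abs_mul, abs_neg, abs_mul, abs_of_pos h0, abs_of_pos h1,
      abs_of_pos h2]
    have h4 : Int.fract (Int.fract (Int.fract α)⁻¹)⁻¹ ≤ (Int.fract (Int.fract α)⁻¹)⁻¹ - 1 := by
      have : (1 : ℤ) ≤ ⌊(Int.fract (Int.fract α)⁻¹)⁻¹⌋ :=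
        Int.floor_pos.2 (one_lt_inv_fract hα').le
      have h : (1 : ℝ) ≤ ⌊(Int.fract (Int.fract α)⁻¹)⁻¹⌋ := by exact_mod_cast this
      rw [Int.fract]; linarith
    have h5 : Int.fract (Int.fract α)⁻¹ * (Int.fract (Int.fract α)⁻¹)⁻¹ = 1 :=
      mul_inv_cancel₀ h1.ne'
    have h6 := mul_le_mul_of_nonneg_left h4 (mul_pos h0 h1).le
    nlinarith
  | succ n ih =>
    intro α hα
    have h0 := fract_pos_of_irrational hα
    have := ih (irrational_inv_fract hα)
    rw [delta_succ hα, delta_succ hα, delta_succ hα, abs_neg, abs_neg, abs_neg, abs_mul, abs_mul,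
      abs_mul, abs_of_pos h0, ← mul_add]
    exact mul_le_mul_of_nonneg_left this h0.le

theorem abs_delta_succ_lt {α : ℝ} (hα : Irrational α) (n : ℕ) :
    |delta α (n + 1)| < |delta α n| := by
  have := abs_delta_add_le n hα
  have := abs_delta_pos hα (n + 2)
  linarith

theorem abs_delta_lt_one {α : ℝ} (hα : Irrational α) (n : ℕ) : |delta α n| < 1 := by
  induction n with
  | zero => rw [delta_zero, abs_of_pos (fract_pos_of_irrational hα)]; exact Int.fract_lt_one α
  | succ n ih => exact (abs_delta_succ_lt hα n).trans ih

theorem convergent_det (n : ℕ) : ∀ {α : ℝ}, Irrational α →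
    (q α n : ℤ) * p α (n + 1) - p α n * q α (n + 1) = (-1) ^ n := by
  induction n with
  | zero =>
    intro α hα
    rw [q_succ hα, p_succ hα, q_zero, p_zero, p_zero, q_zero]
    push_cast
    ring
  | succ n ih =>
    intro α hα
    have := ih (irrational_inv_fract hα)
    rw [q_succ hα, p_succ hα, q_succ hα, p_succ hα, pow_succ]
    linear_combination -this

theorem q_p_le_succ (n : ℕ) : ∀ {α : ℝ}, Irrational α → 1 < α →
    q α n ≤ q α (n + 1) ∧ p α n ≤ p α (n + 1) := by
  induction n with
  | zero =>
    intro α hα h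
    have h1 : 0 < ⌊α⌋ := Int.floor_pos.2 h.le
    have h2 := p_pos (irrational_inv_fract hα) (one_lt_inv_fract hα) 0
    refine ⟨by rw [q_zero]; exact q_pos α 1, ?_⟩
    rw [p_succ hα, p_zero, q_zero]
    push_cast
    nlinarith
  | succ n ih =>
    intro α hα h
    have h1 : 0 < ⌊α⌋ := Int.floor_pos.2 h.le
    obtain ⟨h2, h3⟩ := ih (irrational_inv_fract hα) (one_lt_inv_fract hα)
    constructor
    · have a := q_succ hα n
      have b := q_succ hα (n + 1)
      omega
    · rw [p_succ hα, p_succ hα]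
      have h4 : (q (Int.fract α)⁻¹ n : ℤ) ≤ q (Int.fract α)⁻¹ (n + 1) := by exact_mod_cast h2
      nlinarith

theorem q_le_succ {α : ℝ} (hα : Irrational α) (n : ℕ) : q α n ≤ q α (n + 1) := by
  cases n with
  | zero => rw [q_zero]; exact q_pos α 1
  | succ n =>
    have h := (q_p_le_succ n (irrational_inv_fract hα) (one_lt_inv_fract hα)).2
    have a := q_succ hα n
    have b := q_succ hα (n + 1)
    omega

/-- The law of best approximation: no nonzero pair `(j, m)` with `|j| < q_{n+1}` gives a smaller
value of `|j α - m|` than `(q_n, p_n)`. -/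
theorem abs_delta_le_of_abs_lt {α : ℝ} (hα : Irrational α) (n : ℕ) (j m : ℤ)
    (hj : |j| < q α (n + 1)) (hne : j ≠ 0 ∨ m ≠ 0) : |delta α n| ≤ |(j : ℝ) * α - m| := by
  by_cases hj0 : j = 0
  · subst hj0
    have hm : m ≠ 0 := by simpa using hne
    have h1 : (1 : ℝ) ≤ |(m : ℝ)| := by exact_mod_cast Int.one_le_abs hm
    have := abs_delta_lt_one hα n
    simp only [Int.cast_zero, zero_mul, zero_sub, abs_neg]
    linarith
  have hdet := convergent_det n hα
  have hsq : ((-1 : ℤ) ^ n) * (-1) ^ n = 1 := by rw [← mul_pow]; simp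
  -- Coordinates of `(j, m)` in the unimodular basis `(q_n, p_n)`, `(q_{n+1}, p_{n+1})`.
  obtain ⟨a, ha⟩ : ∃ a, a = (-1 : ℤ) ^ n * (j * p α (n + 1) - m * q α (n + 1)) := ⟨_, rfl⟩
  obtain ⟨b, hb⟩ : ∃ b, b = (-1 : ℤ) ^ n * (m * q α n - j * p α n) := ⟨_, rfl⟩
  have hjab : j = a * q α n + b * q α (n + 1) := by
    rw [ha, hb]; linear_combination (-j) * hsq - (-1) ^ n * j * hdet
  have hmab : m = a * p α n + b * p α (n + 1) := by
    rw [ha, hb]; linear_combination (-m) * hsq - (-1) ^ n * m * hdet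
  have hval : (j : ℝ) * α - m = a * delta α n + b * delta α (n + 1) := by
    rw [hjab, hmab, delta, delta]; push_cast; ring
  have hqn : (0 : ℤ) < q α n := by exact_mod_cast q_pos α n
  have hqn1 : (0 : ℤ) < q α (n + 1) := by exact_mod_cast q_pos α (n + 1)
  rw [abs_lt] at hj
  have ha0 : a ≠ 0 := by
    intro h
    rw [h, zero_mul, zero_add] at hjab
    have hb0 : b = 0 := by
      by_contra hb0
      rcases lt_or_gt_of_ne hb0 with h | h <;> nlinarith
    rw [hb0] at hjab
    simp at hjab
    exact hj0 hjab
  have hab : a * b ≤ 0 := by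
    by_contra! h
    rcases lt_or_gt_of_ne ha0 with h' | h'
    · have : b < 0 := by nlinarith
      nlinarith
    · have : 0 < b := by nlinarith
      nlinarith
  have hdd : delta α n * delta α (n + 1) < 0 := by
    have h1 := delta_sign n hα
    have h2 := delta_sign (n + 1) hα
    have h3 := mul_pos h1 h2
    have hsq' : ((-1 : ℝ) ^ n) * (-1) ^ n = 1 := by rw [← mul_pow]; simp
    have : (-1) ^ n * delta α n * ((-1) ^ (n + 1) * delta α (n + 1)) =
        -(delta α n * delta α (n + 1)) := by
      rw [pow_succ]
      linear_combination (-delta α n * delta α (n + 1)) * hsq'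
    linarith
  have hab' : (a : ℝ) * b ≤ 0 := by exact_mod_cast hab
  have hprod : 0 ≤ (a * delta α n) * (b * delta α (n + 1)) := by nlinarith
  have h1 : (1 : ℝ) ≤ |(a : ℝ)| := by exact_mod_cast Int.one_le_abs ha0
  rw [hval, (abs_add_eq_add_abs_iff _ _).2 (mul_nonneg_iff.1 hprod), abs_mul]
  nlinarith [abs_nonneg (delta α n), abs_nonneg (b * delta α (n + 1))]

/-! ### Order of the orbits and the dynamical partitions -/

variable {f : CircleDeg1Lift}

theorem iterate_add_intCast (f : CircleDeg1Lift) (i : ℕ) (x : ℝ) (m : ℤ) :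
    f^[i] (x + m) = f^[i] x + m := by
  rw [← CircleDeg1Lift.coe_pow]; exact (f ^ i).map_add_int x m

theorem iterate_sub_intCast (f : CircleDeg1Lift) (i : ℕ) (x : ℝ) (m : ℤ) :
    f^[i] (x - m) = f^[i] x - m := by
  rw [← CircleDeg1Lift.coe_pow]; exact (f ^ i).map_sub_int x m

/-- The points of an orbit, and their integer translates, are in the same order as for the
translation by the rotation number. -/
theorem orbit_lt {i j : ℕ} {a b : ℤ}
    (h : i * f.translationNumber + a < j * f.translationNumber + b) (x : ℝ) :
    f^[i] x + a < f^[j] x + b := by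
  rcases le_total i j with hij | hij
  · obtain ⟨d, rfl⟩ := Nat.exists_eq_add_of_le' hij
    have h1 : ((a - b : ℤ) : ℝ) < (f ^ d).translationNumber := by
      rw [CircleDeg1Lift.translationNumber_pow]; push_cast at h ⊢; linarith
    have h2 := (f ^ d).lt_map_of_int_lt_translationNumber h1 (f^[i] x)
    rw [Function.iterate_add_apply, ← CircleDeg1Lift.coe_pow f d]
    push_cast at h2
    linarith
  · obtain ⟨d, rfl⟩ := Nat.exists_eq_add_of_le' hij
    have h1 : (f ^ d).translationNumber < ((b - a : ℤ) : ℝ) := by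
      rw [CircleDeg1Lift.translationNumber_pow]; push_cast at h ⊢; linarith
    have h2 := (f ^ d).map_lt_of_translationNumber_lt_int h1 (f^[j] x)
    rw [Function.iterate_add_apply, ← CircleDeg1Lift.coe_pow f d]
    push_cast at h2
    linarith

theorem orbit_le (hf : Irrational f.translationNumber) {i j : ℕ} {a b : ℤ}
    (h : i * f.translationNumber + a ≤ j * f.translationNumber + b) (x : ℝ) :
    f^[i] x + a ≤ f^[j] x + b := by
  rcases h.lt_or_eq with h | h
  · exact (orbit_lt h x).le
  · have hij : i = j := by
      by_contra hij
      have h0 : ((i : ℤ) - j : ℤ) ≠ 0 := by omega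
      refine (hf.intCast_mul h0).ne_int (b - a) ?_
      push_cast
      linarith
    subst hij
    have : (a : ℝ) = b := by linarith
    rw [this]

/-- The lift `F^{q_n} - p_n` of `f^{q_n}` that moves points the least. -/
noncomputable def ret (f : CircleDeg1Lift) (n : ℕ) (x : ℝ) : ℝ :=
  f^[q f.translationNumber n] x - (p f.translationNumber n : ℝ)

theorem beta_eq_abs (f : CircleDeg1Lift) (n : ℕ) (x : ℝ) : beta f n x = |ret f n x - x| := by
  rw [beta, interval, uIoo, Real.volume_real_Ioo_of_le inf_le_sup, max_sub_min_eq_abs]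
  rfl

theorem ret_iterate (f : CircleDeg1Lift) (n i : ℕ) (x : ℝ) :
    ret f n (f^[i] x) = f^[i] (ret f n x) := by
  rw [ret, ret, iterate_sub_intCast, ← Function.iterate_add_apply, ← Function.iterate_add_apply,
    add_comm]

theorem ret_add_intCast (f : CircleDeg1Lift) (n : ℕ) (x : ℝ) (m : ℤ) :
    ret f n (x + m) = ret f n x + m := by
  rw [ret, ret, iterate_add_intCast]; ring

theorem ret_ret (f : CircleDeg1Lift) (n m : ℕ) (x : ℝ) :
    ret f n (ret f m x) = ret f m (ret f n x) := by
  have h1 := ret_iterate f n (q f.translationNumber m) x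
  have h2 := ret_add_intCast f n (f^[q f.translationNumber m] x) (-p f.translationNumber m)
  push_cast at h2
  rw [← sub_eq_add_neg, ← sub_eq_add_neg] at h2
  exact h2.trans (by rw [h1]; rfl)

theorem beta_add_intCast (f : CircleDeg1Lift) (n : ℕ) (x : ℝ) (m : ℤ) :
    beta f n (x + m) = beta f n x := by
  rw [beta_eq_abs, beta_eq_abs, ret_add_intCast]; congr 1; ring

theorem ret_sub_sign (hf : Irrational f.translationNumber) (n : ℕ) (x : ℝ) :
    0 < (-1) ^ n * (ret f n x - x) := by
  have h := delta_sign n hf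
  rw [delta] at h
  rcases neg_one_pow_eq_or ℝ n with hn | hn <;> rw [hn] at h ⊢
  · have := @orbit_lt f 0 (q f.translationNumber n) 0 (-p f.translationNumber n)
      (by push_cast; linarith) x
    rw [ret]; push_cast at this; simp at this; linarith
  · have := @orbit_lt f (q f.translationNumber n) 0 (-p f.translationNumber n) 0
      (by push_cast; linarith) x
    rw [ret]; push_cast at this; simp at this; linarith

theorem beta_eq_mul (hf : Irrational f.translationNumber) (n : ℕ) (x : ℝ) :
    beta f n x = (-1) ^ n * (ret f n x - x) := by
  rw [beta_eq_abs, ← abs_of_pos (ret_sub_sign hf n x), abs_mul, abs_pow]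
  simp

theorem beta_pos (hf : Irrational f.translationNumber) (n : ℕ) (x : ℝ) : 0 < beta f n x := by
  rw [beta_eq_mul hf]; exact ret_sub_sign hf n x

theorem beta_lt_one (hf : Irrational f.translationNumber) (n : ℕ) (x : ℝ) : beta f n x < 1 := by
  have h := abs_lt.1 (abs_delta_lt_one hf n)
  rw [delta] at h
  rw [beta_eq_abs, abs_lt, ret]
  have h1 := @orbit_lt f 0 (q f.translationNumber n) (-1) (-p f.translationNumber n)
    (by push_cast; linarith) x
  have h2 := @orbit_lt f (q f.translationNumber n) 0 (-p f.translationNumber n) 1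
    (by push_cast; linarith) x
  push_cast at h1 h2
  simp only [Function.iterate_zero, id] at h1 h2
  constructor <;> linarith

/-- Open intervals `(f^{i+s}(x) - r, f^{i+s'}(x) - r')`, `0 ≤ i < q_{n+1}`, that span the angle
`α_n` have disjoint projections to the circle, so that their lengths add up to a bounded
quantity. -/
theorem sum_orbit_intervals_le (hf : Irrational f.translationNumber) (n : ℕ) (s s' : ℕ) (r r' : ℤ)
    (hs : (s' * f.translationNumber - r') - (s * f.translationNumber - r) =
      |delta f.translationNumber n|) (x : ℝ) :
    ∑ i ∈ Finset.range (q f.translationNumber (n + 1)),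
      ((f^[i + s'] x - r') - (f^[i + s] x - r)) ≤ 2 := by
  set τ := f.translationNumber with hτ
  set Q := q τ (n + 1)
  set lo : ℕ → ℝ := fun i => f^[i + s] x - r with hlo
  set hi : ℕ → ℝ := fun i => f^[i + s'] x - r' with hhi
  have hd0 := abs_delta_pos hf n
  have hd1 := abs_delta_lt_one hf n
  have hlen0 : ∀ i, lo i ≤ hi i := by
    intro i
    have := @orbit_le f hf (i + s) (i + s') (-r) (-r') (by push_cast; linarith) x
    push_cast at this
    simp only [hlo, hhi]; linarith
  have hlen1 : ∀ i, hi i ≤ lo i + 1 := by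
    intro i
    have := @orbit_le f hf (i + s') (i + s) (-r') (-r + 1) (by push_cast; linarith) x
    push_cast at this
    simp only [hlo, hhi]; linarith
  -- Each interval is translated by an integer so that its left endpoint lies in `[0, 1)`.
  set J : ℕ → Set ℝ := fun i => Ioo (lo i - ⌊lo i⌋) (hi i - ⌊lo i⌋) with hJ
  have hdisj : Set.PairwiseDisjoint (↑(Finset.range Q)) J := by
    intro i hi' j hj' hij
    have hiQ : i < Q := by simpa using hi'
    have hjQ : j < Q := by simpa using hj'
    have hbest := abs_delta_le_of_abs_lt hf n ((i : ℤ) - j) (⌊lo i⌋ - ⌊lo j⌋)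
      (by rw [abs_lt]; constructor <;> omega) (Or.inl (by omega))
    push_cast at hbest
    rw [Function.onFun, Set.disjoint_left]
    rintro y ⟨hy1, hy2⟩ ⟨hy3, hy4⟩
    rcases le_abs.1 hbest with h | h
    · have := @orbit_le f hf (j + s') (i + s) (-r' - ⌊lo j⌋) (-r - ⌊lo i⌋)
        (by push_cast; linarith) x
      push_cast at this
      simp only [hhi] at hy4
      have : hi j - ⌊lo j⌋ ≤ lo i - ⌊lo i⌋ := by simp only [hhi, hlo] at this ⊢; linarith
      linarith
    · have := @orbit_le f hf (i + s') (j + s) (-r' - ⌊lo i⌋) (-r - ⌊lo j⌋)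
        (by push_cast; linarith) x
      push_cast at this
      have : hi i - ⌊lo i⌋ ≤ lo j - ⌊lo j⌋ := by simp only [hhi, hlo] at this ⊢; linarith
      linarith
  have hsub : (⋃ i ∈ Finset.range Q, J i) ⊆ Icc 0 2 := by
    intro y hy
    simp only [mem_iUnion] at hy
    obtain ⟨i, -, hy1, hy2⟩ := hy
    have h1 := Int.floor_le (lo i)
    have h2 := Int.lt_floor_add_one (lo i)
    have h3 := hlen1 i
    constructor <;> linarith
  have hvol := measure_mono (μ := volume) hsub
  rw [measure_biUnion_finset hdisj (fun i _ => measurableSet_Ioo), Real.volume_Icc] at hvol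
  simp only [hJ, Real.volume_Ioo] at hvol
  rw [← ENNReal.ofReal_sum_of_nonneg (fun i _ => by linarith [hlen0 i]),
    ENNReal.ofReal_le_ofReal_iff (by norm_num)] at hvol
  calc _ = ∑ i ∈ Finset.range Q, (hi i - ⌊lo i⌋ - (lo i - ⌊lo i⌋)) :=
        Finset.sum_congr rfl fun i _ => by simp only [hhi, hlo]; ring
    _ ≤ 2 := by linarith

theorem sum_beta_le_two (hf : Irrational f.translationNumber) (n : ℕ) (x : ℝ) :
    ∑ i ∈ Finset.range (q f.translationNumber (n + 1)), beta f n (f^[i] x) ≤ 2 := by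
  have h := delta_sign n hf
  have key : ∀ i, ret f n (f^[i] x) =
      f^[i + q f.translationNumber n] x - (p f.translationNumber n : ℝ) := by
    intro i
    rw [ret, ← Function.iterate_add_apply, add_comm]
  rcases neg_one_pow_eq_or ℝ n with hn | hn
  · rw [hn, one_mul] at h
    refine le_trans (le_of_eq ?_) (sum_orbit_intervals_le hf n 0 (q f.translationNumber n) 0
      (p f.translationNumber n) ?_ x)
    · refine Finset.sum_congr rfl fun i _ => ?_
      rw [beta_eq_mul hf, hn, key]; simp
    · rw [abs_of_pos h, delta]; simp
  · rw [hn] at h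
    refine le_trans (le_of_eq ?_) (sum_orbit_intervals_le hf n (q f.translationNumber n) 0
      (p f.translationNumber n) 0 ?_ x)
    · refine Finset.sum_congr rfl fun i _ => ?_
      rw [beta_eq_mul hf, hn, key]; simp
    · rw [abs_of_neg (by linarith), delta]; simp

/-- The range `l ≤ 2 q_{n+1}` consists of two blocks of length `q_{n+1}`, and is long enough for the
images of one fundamental interval to cover the circle. -/
theorem sum_beta_le_four (hf : Irrational f.translationNumber) (n : ℕ) (x : ℝ) {l : ℕ}
    (hl : l ≤ 2 * q f.translationNumber (n + 1)) :
    ∑ i ∈ Finset.range l, beta f n (f^[i] x) ≤ 4 := by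
  have h1 := sum_beta_le_two hf n x
  have h2 := sum_beta_le_two hf n (f^[q f.translationNumber (n + 1)] x)
  calc ∑ i ∈ Finset.range l, beta f n (f^[i] x)
      ≤ ∑ i ∈ Finset.range (q f.translationNumber (n + 1) + q f.translationNumber (n + 1)),
          beta f n (f^[i] x) :=
        Finset.sum_le_sum_of_subset_of_nonneg (Finset.range_mono (by omega))
          fun i _ _ => (beta_pos hf n _).le
    _ ≤ 4 := by
        rw [Finset.sum_range_add]
        simp_rw [← Function.iterate_add_apply] at h2
        simp_rw [add_comm (q f.translationNumber (n + 1))]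
        linarith

/-- Covering of the line by the intervals `[w_l + m, w_{l+q} + m - p]` of a sequence `w` which is
ordered like `l θ` modulo integers. -/
theorem exists_mem_Icc_of_order {w : ℕ → ℝ} {θ : ℝ}
    (H : ∀ {i j : ℕ} {a b : ℤ}, i * θ + a < j * θ + b → w i + a < w j + b)
    {qn Q : ℕ} {pn P : ℤ} (hq : qn ≤ Q) (hQ : 0 < Q)
    (h1 : Q * θ - P < 0) (h2 : 0 < (qn * θ - pn) + (Q * θ - P)) (ξ : ℝ) :
    ∃ l < 2 * Q, ∃ m : ℤ, ξ ∈ Icc (w l + m) (w (l + qn) + m - pn) := by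
  -- The point `w l + m`, `l < Q`, next to `ξ` on its left.
  obtain ⟨l, hl, hmax⟩ := Finset.exists_max_image (Finset.range Q)
    (fun l => w l + ⌊ξ - w l⌋) ⟨0, by simpa using hQ⟩
  have hl : l < Q := by simpa using hl
  set m := ⌊ξ - w l⌋ with hm
  have hz : w l + m ≤ ξ := by have := Int.floor_le (ξ - w l); linarith
  have hright : ∀ l' < Q, ∀ m' : ℤ, w l + m < w l' + m' → ξ < w l' + m' := by
    intro l' hl' m' h
    by_contra! hcon
    have h3 : m' ≤ ⌊ξ - w l'⌋ := Int.le_floor.2 (by linarith)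
    have h4 : (m' : ℝ) ≤ ⌊ξ - w l'⌋ := by exact_mod_cast h3
    have := hmax l' (by simpa using hl')
    linarith
  by_cases hlq : l + qn < Q
  · refine ⟨l, by omega, m, hz, ?_⟩
    have h3 := @H l (l + qn) m (m - pn) (by push_cast; linarith)
    have h4 := hright _ hlq _ h3
    push_cast at h4
    linarith
  · have h3 := @H l (l + qn - Q) m (m - pn + P)
      (by rw [Nat.cast_sub (by omega)]; push_cast; linarith)
    have h4 := hright _ (by omega) _ h3
    have h5 := @H (l + qn - Q) (l + qn + qn) (m - pn + P) (m - pn - pn)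
      (by rw [Nat.cast_sub (by omega)]; push_cast; linarith)
    push_cast at h4 h5
    by_cases h6 : ξ ≤ w (l + qn) + m - pn
    · exact ⟨l, by omega, m, hz, h6⟩
    · refine ⟨l + qn, by omega, m - pn, ?_, ?_⟩ <;> push_cast <;> linarith

/-- The images of a fundamental interval `[x₀, f^{q_n}(x₀)]` under `f^l`, `l < 2 q_{n+1}`, cover
the circle. -/
theorem exists_iterate_mem (hf : Irrational f.translationNumber) (hc : Continuous f) (n : ℕ)
    (x₀ x : ℝ) : ∃ l < 2 * q f.translationNumber (n + 1), ∃ m : ℤ,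
      ∃ y ∈ uIcc x₀ (ret f n x₀), x = f^[l] y + m := by
  have hq := q_le_succ hf n
  have hQ := q_pos f.translationNumber (n + 1)
  have h0 := delta_sign n hf
  have h1 := delta_sign (n + 1) hf
  have h2 := abs_delta_succ_lt hf n
  have hret : ∀ l, f^[l] (ret f n x₀) =
      f^[l + q f.translationNumber n] x₀ - (p f.translationNumber n : ℝ) := by
    intro l
    rw [← ret_iterate, ret, ← Function.iterate_add_apply, add_comm]
  suffices h : ∃ l < 2 * q f.translationNumber (n + 1), ∃ m : ℤ,
      x - m ∈ uIcc (f^[l] x₀) (f^[l] (ret f n x₀)) by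
    obtain ⟨l, hl, m, hm⟩ := h
    obtain ⟨y, hy, hxy⟩ := intermediate_value_uIcc (hc.iterate l).continuousOn hm
    exact ⟨l, hl, m, y, hy, by rw [hxy]; ring⟩
  rcases neg_one_pow_eq_or ℝ n with hn | hn
  · rw [pow_succ, hn] at h1
    rw [hn] at h0
    rw [abs_of_pos (a := delta _ n) (by linarith),
      abs_of_neg (a := delta _ (n + 1)) (by linarith)] at h2
    rw [delta] at h0 h1 h2
    rw [delta] at h2
    obtain ⟨l, hl, m, h3, h4⟩ := exists_mem_Icc_of_order (w := fun l => f^[l] x₀)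
      (θ := f.translationNumber) (fun h => orbit_lt h x₀) (pn := p f.translationNumber n)
      (P := p f.translationNumber (n + 1)) hq hQ (by linarith) (by linarith) x
    refine ⟨l, hl, m, ?_⟩
    rw [hret, mem_uIcc]
    left; constructor <;> linarith
  · rw [pow_succ, hn] at h1
    rw [hn] at h0
    rw [abs_of_neg (a := delta _ n) (by linarith),
      abs_of_pos (a := delta _ (n + 1)) (by linarith)] at h2
    rw [delta] at h0 h1 h2
    rw [delta] at h2
    -- For odd `n` the order is reversed: the orbit is replaced by its opposite.
    obtain ⟨l, hl, m, h3, h4⟩ := exists_mem_Icc_of_order (w := fun l => -f^[l] x₀)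
      (θ := -f.translationNumber)
      (fun {i j a b} h => by
        have := @orbit_lt f j i (-b) (-a) (by push_cast; linarith) x₀
        push_cast at this
        linarith) (pn := -p f.translationNumber n)
      (P := -p f.translationNumber (n + 1)) hq hQ (by push_cast; linarith)
      (by push_cast; linarith) (-x)
    refine ⟨l, hl, -m, ?_⟩
    push_cast at h3 h4 ⊢
    rw [hret, mem_uIcc]
    right; constructor <;> linarith

/-! ### Denjoy estimates -/

theorem exists_forall_le_of_periodic {g : ℝ → ℝ} (hc : Continuous g)
    (hp : ∀ x, g (x + 1) = g x) : ∃ x₀, ∀ x, g x₀ ≤ g x := by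
  obtain ⟨x₀, -, h⟩ := isCompact_Icc.exists_isMinOn (nonempty_Icc.2 (zero_le_one' ℝ)) hc.continuousOn
  refine ⟨x₀, fun x => ?_⟩
  obtain ⟨y, hy, hxy⟩ := Function.Periodic.exists_mem_Ico₀ (f := g) hp one_pos x
  rw [hxy]
  exact h (Ico_subset_Icc_self hy)

theorem exists_forall_ge_of_periodic {g : ℝ → ℝ} (hc : Continuous g)
    (hp : ∀ x, g (x + 1) = g x) : ∃ x₀, ∀ x, g x ≤ g x₀ := by
  obtain ⟨x₀, h⟩ := exists_forall_le_of_periodic hc.neg (fun x => by simp [hp])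
  exact ⟨x₀, fun x => neg_le_neg_iff.1 (h x)⟩

theorem exists_abs_le_of_periodic {g : ℝ → ℝ} (hc : Continuous g)
    (hp : ∀ x, g (x + 1) = g x) : ∃ K, 0 < K ∧ ∀ x, |g x| ≤ K := by
  obtain ⟨x₀, h⟩ := exists_forall_ge_of_periodic hc.abs (fun x => by rw [hp])
  exact ⟨|g x₀| + 1, by positivity, fun x => by linarith [h x]⟩

theorem deriv_add_one_of_periodic {g : ℝ → ℝ} (hp : ∀ x, g (x + 1) = g x) (x : ℝ) :
    deriv g (x + 1) = deriv g x := by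
  rw [← deriv_comp_add_const]
  congr 1
  exact funext hp

/-- The logarithm of the derivative of `f`. -/
noncomputable def logD (f : CircleDeg1Lift) (x : ℝ) : ℝ := Real.log (deriv f x)

/-- The logarithm of the derivative of `f^l`, as a Birkhoff sum. -/
noncomputable def logDIter (f : CircleDeg1Lift) (l : ℕ) (x : ℝ) : ℝ :=
  ∑ i ∈ Finset.range l, logD f (f^[i] x)

theorem beta_le_bigM (hf : Irrational f.translationNumber) (n : ℕ) (x : ℝ) :
    beta f n x ≤ bigM f n :=
  le_ciSup (f := fun x => beta f n x) ⟨1, by rintro _ ⟨y, rfl⟩; exact (beta_lt_one hf n y).le⟩ x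

theorem bigM_pos (hf : Irrational f.translationNumber) (n : ℕ) : 0 < bigM f n :=
  (beta_pos hf n 0).trans_le (beta_le_bigM hf n 0)

theorem bigM_le_one (hf : Irrational f.translationNumber) (n : ℕ) : bigM f n ≤ 1 :=
  ciSup_le fun x => (beta_lt_one hf n x).le

theorem smallM_le_beta (n : ℕ) (x : ℝ) : smallM f n ≤ beta f n x :=
  ciInf_le (f := fun x => beta f n x)
    ⟨0, by rintro _ ⟨y, rfl⟩; simp only [beta_eq_abs]; positivity⟩ x

theorem deriv_add_one (f : CircleDeg1Lift) (x : ℝ) : deriv f (x + 1) = deriv f x := by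
  rw [← deriv_comp_add_const]
  have : (fun x => f (x + 1)) = fun x => f x + 1 := funext f.map_add_one
  rw [this, deriv_add_const]

theorem logD_add_one (f : CircleDeg1Lift) (x : ℝ) : logD f (x + 1) = logD f x := by
  rw [logD, logD, deriv_add_one]

theorem logD_add_intCast (f : CircleDeg1Lift) (x : ℝ) (m : ℤ) : logD f (x + m) = logD f x := by
  have h : Function.Periodic (logD f) 1 := logD_add_one f
  simpa using h.int_mul m x

theorem logDIter_add_intCast (f : CircleDeg1Lift) (l : ℕ) (x : ℝ) (m : ℤ) :
    logDIter f l (x + m) = logDIter f l x := by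
  simp only [logDIter, iterate_add_intCast, logD_add_intCast]

theorem logDIter_add_one (f : CircleDeg1Lift) (l : ℕ) (x : ℝ) :
    logDIter f l (x + 1) = logDIter f l x := by
  simpa using logDIter_add_intCast f l x 1

theorem logDIter_add (f : CircleDeg1Lift) (l m : ℕ) (x : ℝ) :
    logDIter f (l + m) x = logDIter f l x + logDIter f m (f^[l] x) := by
  simp only [logDIter, Finset.sum_range_add, ← Function.iterate_add_apply]
  simp only [add_comm l]

theorem logDIter_ret (f : CircleDeg1Lift) (l n : ℕ) (x : ℝ) :
    logDIter f l (ret f n x) = logDIter f l (f^[q f.translationNumber n] x) := by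
  have := logDIter_add_intCast f l (f^[q f.translationNumber n] x) (-p f.translationNumber n)
  push_cast at this
  rw [ret, sub_eq_add_neg, this]

/-- The chain rule for the two ways of writing the derivative of `f^l ∘ f^{q_n}`. -/
theorem logDIter_q_iterate (f : CircleDeg1Lift) (l n : ℕ) (x : ℝ) :
    logDIter f (q f.translationNumber n) (f^[l] x) =
      logDIter f (q f.translationNumber n) x + logDIter f l (ret f n x) - logDIter f l x := by
  rw [logDIter_ret]
  have h1 := logDIter_add f l (q f.translationNumber n) x
  have h2 := logDIter_add f (q f.translationNumber n) l x
  rw [add_comm] at h1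
  linarith

theorem hasDerivAt_iterate_exp (hd : Differentiable ℝ f) (hpos : ∀ x, 0 < deriv f x) (l : ℕ)
    (x : ℝ) : HasDerivAt f^[l] (Real.exp (logDIter f l x)) x := by
  induction l with
  | zero => simpa [logDIter] using hasDerivAt_id x
  | succ l ih =>
    rw [Function.iterate_succ', logDIter, Finset.sum_range_succ, Real.exp_add, mul_comm]
    have h : Real.exp (logD f (f^[l] x)) = deriv f (f^[l] x) := Real.exp_log (hpos _)
    rw [h]
    exact (hd _).hasDerivAt.comp x ih

theorem hasDerivAt_ret (hd : Differentiable ℝ f) (hpos : ∀ x, 0 < deriv f x) (n : ℕ)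
    (x : ℝ) : HasDerivAt (ret f n) (Real.exp (logDIter f (q f.translationNumber n) x)) x :=
  (hasDerivAt_iterate_exp hd hpos _ x).sub_const _

theorem hasDerivAt_beta (hf : Irrational f.translationNumber) (hd : Differentiable ℝ f)
    (hpos : ∀ x, 0 < deriv f x) (n : ℕ) (x : ℝ) : HasDerivAt (beta f n)
      ((-1) ^ n * (Real.exp (logDIter f (q f.translationNumber n) x) - 1)) x := by
  have h : beta f n = fun x => (-1) ^ n * (ret f n x - x) := funext (beta_eq_mul hf n)
  rw [h]
  exact ((hasDerivAt_ret hd hpos n x).sub (hasDerivAt_id x)).const_mul _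

theorem continuous_beta (hf : Irrational f.translationNumber) (hd : Differentiable ℝ f)
    (hpos : ∀ x, 0 < deriv f x) (n : ℕ) : Continuous (beta f n) :=
  continuous_iff_continuousAt.2 fun x => (hasDerivAt_beta hf hd hpos n x).continuousAt

theorem exists_bigM_eq (hf : Irrational f.translationNumber) (hd : Differentiable ℝ f)
    (hpos : ∀ x, 0 < deriv f x) (n : ℕ) : ∃ x, bigM f n = beta f n x := by
  obtain ⟨x, hx⟩ := exists_forall_ge_of_periodic (continuous_beta hf hd hpos n)
    (fun x => by simpa using beta_add_intCast f n x 1)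
  exact ⟨x, le_antisymm (ciSup_le hx) (beta_le_bigM hf n x)⟩

theorem exists_smallM_eq (hf : Irrational f.translationNumber) (hd : Differentiable ℝ f)
    (hpos : ∀ x, 0 < deriv f x) (n : ℕ) : ∃ x, smallM f n = beta f n x := by
  obtain ⟨x, hx⟩ := exists_forall_le_of_periodic (continuous_beta hf hd hpos n)
    (fun x => by simpa using beta_add_intCast f n x 1)
  exact ⟨x, le_antisymm (smallM_le_beta n x) (le_ciInf hx)⟩

theorem contDiff_logD {k : ℕ} (hC : ContDiff ℝ (k + 1 : ℕ) f) (hpos : ∀ x, 0 < deriv f x) :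
    ContDiff ℝ k (logD f) := by
  have h : ContDiff ℝ k (deriv f) := by
    have h1 : ContDiff ℝ ((k : WithTop ℕ∞) + 1) f := by exact_mod_cast hC
    exact (contDiff_succ_iff_deriv.1 h1).2.2
  exact h.log fun x => (hpos x).ne'

theorem contDiff_iterate {k : WithTop ℕ∞} (hC : ContDiff ℝ k f) (l : ℕ) :
    ContDiff ℝ k f^[l] := by
  induction l with
  | zero => exact contDiff_id
  | succ l ih => rw [Function.iterate_succ']; exact hC.comp ih

theorem contDiff_logDIter {k : ℕ} (hC : ContDiff ℝ (k + 1 : ℕ) f) (hpos : ∀ x, 0 < deriv f x)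
    (l : ℕ) : ContDiff ℝ k (logDIter f l) := by
  have h1 := contDiff_logD hC hpos
  have h2 : ContDiff ℝ k f := hC.of_le (by exact_mod_cast Nat.le_succ k)
  exact ContDiff.sum fun i _ => h1.comp (contDiff_iterate h2 i)

theorem iterate_mem_uIcc (f : CircleDeg1Lift) (i : ℕ) {x y z : ℝ} (h : y ∈ uIcc x z) :
    f^[i] y ∈ uIcc (f^[i] x) (f^[i] z) :=
  (f.monotone.iterate i).mapsTo_uIcc h

theorem abs_iterate_sub_le_beta (n i : ℕ) {x y : ℝ} (h : y ∈ uIcc x (ret f n x)) :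
    |f^[i] y - f^[i] x| ≤ beta f n (f^[i] x) := by
  rw [beta_eq_abs, ret_iterate]
  exact abs_sub_left_of_mem_uIcc (iterate_mem_uIcc f i h)

/-- Bounded distortion of `f^l`, `l ≤ 2 q_{n+1}`, on the intervals `I_n(x)`. -/
theorem exists_distortion (hf : Irrational f.translationNumber) (hC : ContDiff ℝ 2 f)
    (hpos : ∀ x, 0 < deriv f x) : ∃ D, 0 < D ∧ ∀ (n l : ℕ) (x y : ℝ),
      l ≤ 2 * q f.translationNumber (n + 1) → y ∈ uIcc x (ret f n x) →
        |logDIter f l y - logDIter f l x| ≤ D := by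
  have h1 : ContDiff ℝ 1 (logD f) := contDiff_logD (k := 1) (by exact_mod_cast hC) hpos
  obtain ⟨K, hK0, hK⟩ := exists_abs_le_of_periodic (h1.continuous_deriv le_rfl)
    (deriv_add_one_of_periodic (logD_add_one f))
  have hlip : ∀ x y, |logD f y - logD f x| ≤ K * |y - x| := fun x y =>
    Convex.norm_image_sub_le_of_norm_deriv_le (s := univ)
      (fun z _ => (h1.differentiable one_ne_zero) z) (fun z _ => hK z) convex_univ
      (mem_univ x) (mem_univ y)
  refine ⟨K * 4, by positivity, fun n l x y hl hy => ?_⟩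
  calc |logDIter f l y - logDIter f l x|
      = |∑ i ∈ Finset.range l, (logD f (f^[i] y) - logD f (f^[i] x))| := by
        rw [logDIter, logDIter, Finset.sum_sub_distrib]
    _ ≤ ∑ i ∈ Finset.range l, |logD f (f^[i] y) - logD f (f^[i] x)| :=
        Finset.abs_sum_le_sum_abs _ _
    _ ≤ ∑ i ∈ Finset.range l, K * beta f n (f^[i] x) :=
        Finset.sum_le_sum fun i _ => (hlip _ _).trans
          (mul_le_mul_of_nonneg_left (abs_iterate_sub_le_beta n i hy) hK0.le)
    _ ≤ K * 4 := by
        rw [← Finset.mul_sum]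
        exact mul_le_mul_of_nonneg_left (sum_beta_le_four hf n x hl) hK0.le

theorem exists_mem_uIcc_sub_eq {g g' : ℝ → ℝ} (h : ∀ z, HasDerivAt g (g' z) z) (x y : ℝ) :
    ∃ ξ ∈ uIcc x y, g y - g x = g' ξ * (y - x) := by
  have hc : Continuous g := continuous_iff_continuousAt.2 fun z => (h z).continuousAt
  rcases lt_trichotomy x y with hxy | rfl | hxy
  · obtain ⟨ξ, hξ, he⟩ := exists_hasDerivAt_eq_slope g g' hxy hc.continuousOn fun z _ => h z
    refine ⟨ξ, Icc_subset_uIcc (Ioo_subset_Icc_self hξ), ?_⟩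
    have : y - x ≠ 0 := by linarith
    rw [he]; field_simp
  · exact ⟨x, left_mem_uIcc, by simp⟩
  · obtain ⟨ξ, hξ, he⟩ := exists_hasDerivAt_eq_slope g g' hxy hc.continuousOn fun z _ => h z
    refine ⟨ξ, Icc_subset_uIcc' (Ioo_subset_Icc_self hξ), ?_⟩
    have : x - y ≠ 0 := by linarith
    rw [he]; field_simp; ring

/-- Bounded distortion, integrated: `(f^l)'(x) |I_n(x)|` is at most comparable to the length of
`f^l(I_n(x)) = I_n(f^l(x))`. -/
theorem exists_exp_mul_beta_le (hf : Irrational f.translationNumber) (hC : ContDiff ℝ 2 f)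
    (hpos : ∀ x, 0 < deriv f x) : ∃ C, 0 < C ∧ ∀ (n l : ℕ) (x : ℝ),
      l ≤ 2 * q f.translationNumber (n + 1) →
        Real.exp (logDIter f l x) * beta f n x ≤ C * beta f n (f^[l] x) := by
  obtain ⟨D, hD0, hD⟩ := exists_distortion hf hC hpos
  refine ⟨Real.exp D, Real.exp_pos D, fun n l x hl => ?_⟩
  have hd : Differentiable ℝ f := hC.differentiable two_ne_zero
  obtain ⟨ξ, hξ, h⟩ := exists_mem_uIcc_sub_eq (hasDerivAt_iterate_exp hd hpos l) x (ret f n x)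
  have h1 : beta f n (f^[l] x) = Real.exp (logDIter f l ξ) * beta f n x := by
    rw [beta_eq_abs, beta_eq_abs, ret_iterate, h, abs_mul, Real.abs_exp]
  rw [h1, ← mul_assoc, ← Real.exp_add]
  have h2 := (abs_le.1 (hD n l x ξ hl hξ)).1
  exact mul_le_mul_of_nonneg_right (Real.exp_le_exp.2 (by linarith)) (beta_pos hf n x).le

theorem exists_sum_exp_mul_beta_le (hf : Irrational f.translationNumber) (hC : ContDiff ℝ 2 f)
    (hpos : ∀ x, 0 < deriv f x) : ∃ C, 0 < C ∧ ∀ (n l : ℕ) (x : ℝ),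
      l ≤ 2 * q f.translationNumber (n + 1) →
        (∑ i ∈ Finset.range l, Real.exp (logDIter f i x)) * beta f n x ≤ C := by
  obtain ⟨C, hC0, h⟩ := exists_exp_mul_beta_le hf hC hpos
  refine ⟨C * 4, by positivity, fun n l x hl => ?_⟩
  calc _ = ∑ i ∈ Finset.range l, Real.exp (logDIter f i x) * beta f n x := Finset.sum_mul _ _ _
    _ ≤ ∑ i ∈ Finset.range l, C * beta f n (f^[i] x) :=
        Finset.sum_le_sum fun i hi => h n i x (by have := Finset.mem_range.1 hi; omega)
    _ ≤ C * 4 := by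
        rw [← Finset.mul_sum]
        exact mul_le_mul_of_nonneg_left (sum_beta_le_four hf n x hl) hC0.le

theorem sum_beta_sq_le (hf : Irrational f.translationNumber) (n : ℕ) (x : ℝ) {l : ℕ}
    (hl : l ≤ 2 * q f.translationNumber (n + 1)) :
    ∑ i ∈ Finset.range l, beta f n (f^[i] x) ^ 2 ≤ 4 * bigM f n := by
  calc ∑ i ∈ Finset.range l, beta f n (f^[i] x) ^ 2
      ≤ ∑ i ∈ Finset.range l, bigM f n * beta f n (f^[i] x) :=
        Finset.sum_le_sum fun i _ => by
          rw [sq]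
          exact mul_le_mul_of_nonneg_right (beta_le_bigM hf n _) (beta_pos hf n _).le
    _ ≤ 4 * bigM f n := by
        rw [← Finset.mul_sum, mul_comm]
        exact mul_le_mul_of_nonneg_right (sum_beta_le_four hf n x hl) (bigM_pos hf n).le

theorem exists_sum_exp_sq_le (hf : Irrational f.translationNumber) (hC : ContDiff ℝ 2 f)
    (hpos : ∀ x, 0 < deriv f x) : ∃ C, 0 < C ∧ ∀ (n l : ℕ) (x : ℝ),
      l ≤ 2 * q f.translationNumber (n + 1) →
        (∑ i ∈ Finset.range l, Real.exp (logDIter f i x) ^ 2) * beta f n x ^ 2 ≤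
          C * bigM f n := by
  obtain ⟨C, hC0, h⟩ := exists_exp_mul_beta_le hf hC hpos
  refine ⟨C ^ 2 * 4, by positivity, fun n l x hl => ?_⟩
  have hb := (beta_pos hf n x).le
  calc _ = ∑ i ∈ Finset.range l, (Real.exp (logDIter f i x) * beta f n x) ^ 2 := by
        rw [Finset.sum_mul]; simp only [mul_pow]
    _ ≤ ∑ i ∈ Finset.range l, C ^ 2 * beta f n (f^[i] x) ^ 2 :=
        Finset.sum_le_sum fun i hi => by
          rw [← mul_pow]
          exact pow_le_pow_left₀ (by positivity)
            (h n i x (by have := Finset.mem_range.1 hi; omega)) 2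
    _ ≤ C ^ 2 * 4 * bigM f n := by
        rw [← Finset.mul_sum, mul_assoc]
        exact mul_le_mul_of_nonneg_left (sum_beta_sq_le hf n x hl) (by positivity)

theorem hasDerivAt_logDIter (hC : ContDiff ℝ 2 f) (hpos : ∀ x, 0 < deriv f x) (l : ℕ) (x : ℝ) :
    HasDerivAt (logDIter f l)
      (∑ i ∈ Finset.range l, deriv (logD f) (f^[i] x) * Real.exp (logDIter f i x)) x := by
  have h1 : ContDiff ℝ 1 (logD f) := contDiff_logD (k := 1) (by exact_mod_cast hC) hpos
  exact HasDerivAt.fun_sum fun i _ => ((h1.differentiable one_ne_zero) _).hasDerivAt.comp x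
    (hasDerivAt_iterate_exp (hC.differentiable two_ne_zero) hpos i x)

/-- The bound `C / β_n(x)` for the nonlinearity of `f^l`, without the factor `M_n^{1/2}` which needs
a third derivative. -/
theorem exists_abs_deriv_logDIter_le (hf : Irrational f.translationNumber) (hC : ContDiff ℝ 2 f)
    (hpos : ∀ x, 0 < deriv f x) : ∃ C, 0 < C ∧ ∀ (n l : ℕ) (x : ℝ),
      l ≤ 2 * q f.translationNumber (n + 1) →
        |deriv (logDIter f l) x| * beta f n x ≤ C := by
  obtain ⟨C, hC0, h⟩ := exists_sum_exp_mul_beta_le hf hC hpos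
  have h1 : ContDiff ℝ 1 (logD f) := contDiff_logD (k := 1) (by exact_mod_cast hC) hpos
  obtain ⟨K, hK0, hK⟩ := exists_abs_le_of_periodic (h1.continuous_deriv le_rfl)
    (deriv_add_one_of_periodic (logD_add_one f))
  refine ⟨K * C, by positivity, fun n l x hl => ?_⟩
  have h2 : |deriv (logDIter f l) x| ≤ K * ∑ i ∈ Finset.range l, Real.exp (logDIter f i x) := by
    rw [(hasDerivAt_logDIter hC hpos l x).deriv, Finset.mul_sum]
    refine (Finset.abs_sum_le_sum_abs _ _).trans (Finset.sum_le_sum fun i _ => ?_)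
    rw [abs_mul, Real.abs_exp]
    exact mul_le_mul_of_nonneg_right (hK _) (Real.exp_pos _).le
  calc _ ≤ K * (∑ i ∈ Finset.range l, Real.exp (logDIter f i x)) * beta f n x :=
        mul_le_mul_of_nonneg_right h2 (beta_pos hf n x).le
    _ ≤ K * C := by rw [mul_assoc]; exact mul_le_mul_of_nonneg_left (h n l x hl) hK0.le

/-- At a minimum of `β_n` the return map `f^{q_n}` has derivative one. -/
theorem logDIter_eq_zero_of_isMin (hf : Irrational f.translationNumber) (hd : Differentiable ℝ f)
    (hpos : ∀ x, 0 < deriv f x) {n : ℕ} {x₀ : ℝ} (h : ∀ x, beta f n x₀ ≤ beta f n x) :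
    logDIter f (q f.translationNumber n) x₀ = 0 := by
  have h1 := IsLocalMin.hasDerivAt_eq_zero (Eventually.of_forall h)
    (hasDerivAt_beta hf hd hpos n x₀)
  rcases neg_one_pow_eq_or ℝ n with hn | hn <;> rw [hn] at h1 <;>
    exact Real.exp_eq_one_iff _ |>.1 (by linarith)

/-- Denjoy's inequality: the derivatives of the maps `f^{q_n}` are uniformly bounded and bounded
away from zero. -/
theorem exists_abs_logDIter_q_le (hf : Irrational f.translationNumber) (hC : ContDiff ℝ 2 f)
    (hpos : ∀ x, 0 < deriv f x) : ∃ C, 0 < C ∧ ∀ (n : ℕ) (x : ℝ),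
      |logDIter f (q f.translationNumber n) x| ≤ C := by
  obtain ⟨D, hD0, hD⟩ := exists_distortion hf hC hpos
  have hd : Differentiable ℝ f := hC.differentiable two_ne_zero
  refine ⟨2 * D, by positivity, fun n x => ?_⟩
  obtain ⟨x₀, hx₀⟩ := exists_forall_le_of_periodic (continuous_beta hf hd hpos n)
    (fun x => by simpa using beta_add_intCast f n x 1)
  have h0 := logDIter_eq_zero_of_isMin hf hd hpos hx₀
  obtain ⟨l, hl, m, y, hy, rfl⟩ := exists_iterate_mem hf hC.continuous n x₀ x
  have h1 := hD n (q f.translationNumber n) x₀ y (by have := q_le_succ hf n; omega) hy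
  have h2 := hD n l y (ret f n y) hl.le right_mem_uIcc
  rw [logDIter_add_intCast, logDIter_q_iterate]
  rw [h0, sub_zero] at h1
  rw [abs_le] at h1 h2 ⊢
  constructor <;> linarith

/-- The lengths `β_n(x)` and `β_n(y)` are comparable when `y` lies in the closure of `I_n(x)`. -/
theorem exists_beta_comparable (hf : Irrational f.translationNumber) (hC : ContDiff ℝ 2 f)
    (hpos : ∀ x, 0 < deriv f x) : ∃ C, 1 ≤ C ∧ ∀ (n : ℕ) (x y : ℝ), y ∈ uIcc x (ret f n x) →
      beta f n y ≤ C * beta f n x ∧ beta f n x ≤ C * beta f n y := by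
  obtain ⟨D, hD0, hD⟩ := exists_abs_logDIter_q_le hf hC hpos
  have hd : Differentiable ℝ f := hC.differentiable two_ne_zero
  have hD1 : 1 ≤ Real.exp D := Real.one_le_exp hD0.le
  refine ⟨Real.exp D, hD1, fun n x y hy => ?_⟩
  obtain ⟨ξ, -, h⟩ := exists_mem_uIcc_sub_eq (hasDerivAt_ret hd hpos n) x y
  have hx := beta_eq_mul hf n x
  have hy' := beta_eq_mul hf n y
  have hb := beta_pos hf n x
  have hD2 := abs_le.1 (hD n ξ)
  have h1 : Real.exp (logDIter f (q f.translationNumber n) ξ) ≤ Real.exp D :=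
    Real.exp_le_exp.2 hD2.2
  have h2 : 1 ≤ Real.exp D * Real.exp (logDIter f (q f.translationNumber n) ξ) := by
    rw [← Real.exp_add]; exact Real.one_le_exp (by linarith)
  set E := Real.exp (logDIter f (q f.translationNumber n) ξ)
  obtain ⟨s, hs⟩ : ∃ s, s = (-1) ^ n * (y - x) := ⟨_, rfl⟩
  have hs0 : 0 ≤ s ∧ s ≤ beta f n x := by
    rcases neg_one_pow_eq_or ℝ n with hn | hn <;> rw [hn] at hs hx <;> rw [mem_uIcc] at hy <;>
      rcases hy with hy | hy <;> constructor <;> linarith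
  have hby : beta f n y = (beta f n x - s) + E * s := by
    rw [hy', hx, hs]; linear_combination (-1) ^ n * h
  have h3 := mul_le_mul_of_nonneg_right h1 hs0.1
  have h4 := mul_le_mul_of_nonneg_right h2 hs0.1
  rw [hby]
  constructor <;> nlinarith

theorem ret_ret_eq (f : CircleDeg1Lift) (n m : ℕ) (x : ℝ) : ret f n (ret f m x) =
    f^[q f.translationNumber n + q f.translationNumber m] x +
      ((-p f.translationNumber n - p f.translationNumber m : ℤ) : ℝ) := by
  rw [ret, ret, iterate_sub_intCast, ← Function.iterate_add_apply]
  push_cast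
  ring

/-- The lengths `β_n` decrease geometrically: for `y = f^{-q_{n+1}}(x)`, the interval
`I_n(x)` contains both `[x, f^{q_{n+2}}(x)]` and the adjacent interval with endpoints
`f^{q_{n+2}}(x)` and `f^{q_{n+2}}(y)`, whose length is at least a fixed fraction of `|y - x|`. -/
theorem exists_one_add_mul_beta_le (hf : Irrational f.translationNumber) (hC : ContDiff ℝ 2 f)
    (hpos : ∀ x, 0 < deriv f x) : ∃ c, 0 < c ∧ ∀ (n : ℕ) (x : ℝ),
      (1 + c) * beta f (n + 2) x ≤ beta f n x := by
  obtain ⟨D, hD0, hD⟩ := exists_abs_logDIter_q_le hf hC hpos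
  have hd : Differentiable ℝ f := hC.differentiable two_ne_zero
  refine ⟨Real.exp (-D), Real.exp_pos _, fun n x => ?_⟩
  obtain ⟨y, rfl⟩ : ∃ y, ret f (n + 1) y = x := by
    have hs := (f.continuous_iff_surjective.1 hC.continuous).iterate
      (q f.translationNumber (n + 1))
    obtain ⟨y, hy⟩ := hs (x + p f.translationNumber (n + 1))
    exact ⟨y, by rw [ret, hy]; ring⟩
  obtain ⟨ξ, -, h⟩ := exists_mem_uIcc_sub_eq (hasDerivAt_ret hd hpos (n + 2)) (ret f (n + 1) y) y
  have hE : Real.exp (-D) ≤ Real.exp (logDIter f (q f.translationNumber (n + 2)) ξ) :=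
    Real.exp_le_exp.2 (abs_le.1 (hD (n + 2) ξ)).1
  set E := Real.exp (logDIter f (q f.translationNumber (n + 2)) ξ)
  have e0 := delta_sign n hf
  have e1 := delta_sign (n + 1) hf
  have e2 := delta_sign (n + 2) hf
  have e3 := abs_delta_add_le n hf
  have e4 := abs_delta_succ_lt hf (n + 1)
  have b1 := beta_eq_mul hf (n + 1) y
  have b1' := beta_pos hf (n + 1) y
  have hb2' := beta_pos hf (n + 2) (ret f (n + 1) y)
  have hr1 := ret_ret_eq f (n + 2) (n + 1) y
  have hr0 := ret_ret_eq f n (n + 1) y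
  rw [beta_eq_mul hf (n + 2), beta_eq_mul hf n]
  rw [beta_eq_mul hf (n + 2)] at hb2'
  have hp1 : (-1 : ℝ) ^ (n + 1) = -(-1) ^ n := by rw [pow_succ]; ring
  have hp2 : (-1 : ℝ) ^ (n + 2) = (-1) ^ n := by rw [pow_succ, pow_succ]; ring
  rw [hp1] at e1 b1
  rw [hp2] at e2 hb2' ⊢
  rcases neg_one_pow_eq_or ℝ n with hn | hn
  · rw [hn] at e0 e1 e2 b1 hb2' ⊢
    rw [abs_of_pos (a := delta _ n) (by linarith), abs_of_neg (a := delta _ (n + 1)) (by linarith),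
      abs_of_pos (a := delta _ (n + 2)) (by linarith)] at e3
    rw [abs_of_neg (a := delta _ (n + 1)) (by linarith), abs_of_pos (by linarith)] at e4
    rw [delta] at e3 e4
    rw [delta] at e3 e4
    rw [delta] at e3
    have o1 := @orbit_lt f (q f.translationNumber (n + 2) + q f.translationNumber (n + 1)) 0
      (-p f.translationNumber (n + 2) - p f.translationNumber (n + 1)) 0
      (by push_cast; linarith) y
    have o2 := @orbit_le f hf (q f.translationNumber (n + 2))
      (q f.translationNumber n + q f.translationNumber (n + 1))
      (-p f.translationNumber (n + 2)) (-p f.translationNumber n - p f.translationNumber (n + 1))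
      (by push_cast; linarith) y
    rw [← hr1] at o1
    rw [← hr0] at o2
    simp only [Function.iterate_zero, id, Int.cast_zero, add_zero] at o1
    rw [Int.cast_neg, ← sub_eq_add_neg] at o2
    change ret f (n + 2) y ≤ _ at o2
    have h5 : Real.exp (-D) * (y - ret f (n + 1) y) ≤ E * (y - ret f (n + 1) y) :=
      mul_le_mul_of_nonneg_right hE (by linarith)
    have h6 := mul_le_mul_of_nonneg_left (a := Real.exp (-D))
      (show ret f (n + 2) (ret f (n + 1) y) - ret f (n + 1) y ≤ y - ret f (n + 1) y by linarith)
      (Real.exp_pos _).le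
    linarith
  · rw [hn] at e0 e1 e2 b1 hb2' ⊢
    rw [abs_of_neg (a := delta _ n) (by linarith), abs_of_pos (a := delta _ (n + 1)) (by linarith),
      abs_of_neg (a := delta _ (n + 2)) (by linarith)] at e3
    rw [abs_of_pos (a := delta _ (n + 1)) (by linarith), abs_of_neg (by linarith)] at e4
    rw [delta] at e3 e4
    rw [delta] at e3 e4
    rw [delta] at e3
    have o1 := @orbit_lt f 0 (q f.translationNumber (n + 2) + q f.translationNumber (n + 1)) 0
      (-p f.translationNumber (n + 2) - p f.translationNumber (n + 1))
      (by push_cast; linarith) y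
    have o2 := @orbit_le f hf (q f.translationNumber n + q f.translationNumber (n + 1))
      (q f.translationNumber (n + 2)) (-p f.translationNumber n - p f.translationNumber (n + 1))
      (-p f.translationNumber (n + 2))
      (by push_cast; linarith) y
    rw [← hr1] at o1
    rw [← hr0] at o2
    simp only [Function.iterate_zero, id, Int.cast_zero, add_zero] at o1
    rw [Int.cast_neg, ← sub_eq_add_neg] at o2
    change _ ≤ ret f (n + 2) y at o2
    have h5 : Real.exp (-D) * (ret f (n + 1) y - y) ≤ E * (ret f (n + 1) y - y) :=
      mul_le_mul_of_nonneg_right hE (by linarith)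
    have h6 := mul_le_mul_of_nonneg_left (a := Real.exp (-D))
      (show ret f (n + 1) y - ret f (n + 2) (ret f (n + 1) y) ≤ ret f (n + 1) y - y by linarith)
      (Real.exp_pos _).le
    linarith

/-- Denjoy's theorem, in the form `M_n → 0`. -/
theorem tendsto_bigM (hf : Irrational f.translationNumber) (hC : ContDiff ℝ 2 f)
    (hpos : ∀ x, 0 < deriv f x) : Tendsto (bigM f) atTop (nhds 0) := by
  obtain ⟨c, hc0, hc⟩ := exists_one_add_mul_beta_le hf hC hpos
  have hstep : ∀ n, bigM f (n + 2) ≤ (1 + c)⁻¹ * bigM f n := by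
    intro n
    refine ciSup_le fun x => ?_
    rw [← div_eq_inv_mul, le_div_iff₀ (by positivity), mul_comm]
    exact (hc n x).trans (beta_le_bigM hf n x)
  have hle : ∀ m, bigM f (2 * m) ≤ (1 + c)⁻¹ ^ m ∧ bigM f (2 * m + 1) ≤ (1 + c)⁻¹ ^ m := by
    intro m
    induction m with
    | zero => simpa using ⟨bigM_le_one hf 0, bigM_le_one hf 1⟩
    | succ m ih =>
      rw [pow_succ']
      exact ⟨(hstep (2 * m)).trans (mul_le_mul_of_nonneg_left ih.1 (by positivity)),
        (hstep (2 * m + 1)).trans (mul_le_mul_of_nonneg_left ih.2 (by positivity))⟩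
  have hlim : Tendsto (fun n : ℕ => (1 + c)⁻¹ ^ (n / 2)) atTop (nhds 0) :=
    (tendsto_pow_atTop_nhds_zero_of_lt_one (by positivity)
      (inv_lt_one_of_one_lt₀ (by linarith))).comp (Nat.tendsto_div_const_atTop two_ne_zero)
  refine squeeze_zero (fun n => (bigM_pos hf n).le) (fun n => ?_) hlim
  rcases Nat.even_or_odd' n with ⟨m, rfl | rfl⟩
  · rw [show 2 * m / 2 = m by omega]; exact (hle m).1
  · rw [show (2 * m + 1) / 2 = m by omega]; exact (hle m).2

/-! ### The Schwarzian derivative -/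

/-- The Schwarzian derivative of `f^l`, written in terms of `log (f^l)'`. -/
noncomputable def schwarzian (f : CircleDeg1Lift) (l : ℕ) (x : ℝ) : ℝ :=
  deriv (deriv (logDIter f l)) x - deriv (logDIter f l) x ^ 2 / 2

/-- The Schwarzian derivative of `f`. -/
noncomputable def schwarzianOne (f : CircleDeg1Lift) (x : ℝ) : ℝ :=
  deriv (deriv (logD f)) x - deriv (logD f) x ^ 2 / 2

theorem hasDerivAt_deriv {g : ℝ → ℝ} (hg : ContDiff ℝ 2 g) (x : ℝ) :
    HasDerivAt (deriv g) (deriv (deriv g) x) x := by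
  have h1 : ContDiff ℝ ((1 : WithTop ℕ∞) + 1) g := by simpa [one_add_one_eq_two] using hg
  exact (((contDiff_succ_iff_deriv.1 h1).2.2.differentiable one_ne_zero) x).hasDerivAt

theorem contDiff_two_logD (hC : ContDiff ℝ 3 f) (hpos : ∀ x, 0 < deriv f x) :
    ContDiff ℝ 2 (logD f) :=
  contDiff_logD (k := 2) (by exact_mod_cast hC) hpos

theorem contDiff_two_logDIter (hC : ContDiff ℝ 3 f) (hpos : ∀ x, 0 < deriv f x) (l : ℕ) :
    ContDiff ℝ 2 (logDIter f l) :=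
  contDiff_logDIter (k := 2) (by exact_mod_cast hC) hpos l

theorem deriv_logDIter_succ (hC : ContDiff ℝ 2 f) (hpos : ∀ x, 0 < deriv f x) (l : ℕ) :
    deriv (logDIter f (l + 1)) = fun x => deriv (logDIter f l) x +
      deriv (logD f) (f^[l] x) * Real.exp (logDIter f l x) := by
  ext x
  rw [(hasDerivAt_logDIter hC hpos (l + 1) x).deriv, (hasDerivAt_logDIter hC hpos l x).deriv,
    Finset.sum_range_succ]

/-- The chain rule for the Schwarzian derivative. -/
theorem schwarzian_eq_sum (hC : ContDiff ℝ 3 f) (hpos : ∀ x, 0 < deriv f x) (l : ℕ) (x : ℝ) :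
    schwarzian f l x =
      ∑ i ∈ Finset.range l, schwarzianOne f (f^[i] x) * Real.exp (logDIter f i x) ^ 2 := by
  have hC2 : ContDiff ℝ 2 f := hC.of_le (by norm_num)
  induction l with
  | zero =>
    have : logDIter f 0 = fun _ => 0 := by ext x; simp [logDIter]
    simp [schwarzian, this]
  | succ l ih =>
    have h1 := hasDerivAt_deriv (contDiff_two_logDIter hC hpos l) x
    have h2 := (hasDerivAt_deriv (contDiff_two_logD hC hpos) (f^[l] x)).comp x
      (hasDerivAt_iterate_exp (hC.differentiable three_ne_zero) hpos l x)
    have h3 := (((contDiff_two_logDIter hC hpos l).differentiable two_ne_zero) x).hasDerivAt.exp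
    have h4 := (h1.add (h2.mul h3)).deriv
    rw [Finset.sum_range_succ, ← ih, schwarzian, deriv_logDIter_succ hC2 hpos]
    have h5 : deriv (fun x => deriv (logDIter f l) x +
        deriv (logD f) (f^[l] x) * Real.exp (logDIter f l x)) x = _ := h4
    rw [h5, schwarzian, schwarzianOne]
    simp only [Function.comp]
    ring

theorem continuous_deriv_deriv {g : ℝ → ℝ} (hg : ContDiff ℝ 2 g) :
    Continuous (deriv (deriv g)) := by
  have h1 : ContDiff ℝ ((1 : WithTop ℕ∞) + 1) g := by simpa [one_add_one_eq_two] using hg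
  exact (contDiff_succ_iff_deriv.1 h1).2.2.continuous_deriv le_rfl

/-- By the chain rule, the Schwarzian derivative of `f^l` is `O(∑ i < l, (f^i)'²)`, and
`(f^i)'(x) β_n(x)` is at most comparable to `β_n(f^i(x))`, whose squares add up to `O(M_n)`. -/
theorem exists_abs_schwarzian_le (hf : Irrational f.translationNumber) (hC : ContDiff ℝ 3 f)
    (hpos : ∀ x, 0 < deriv f x) : ∃ C, 0 < C ∧ ∀ (n l : ℕ) (x : ℝ),
      l ≤ 2 * q f.translationNumber (n + 1) →
        |schwarzian f l x| * beta f n x ^ 2 ≤ C * bigM f n := by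
  obtain ⟨C, hC0, h⟩ := exists_sum_exp_sq_le hf (hC.of_le (by norm_num)) hpos
  have h2 := contDiff_two_logD hC hpos
  have hp := deriv_add_one_of_periodic (logD_add_one f)
  obtain ⟨K, hK0, hK⟩ := exists_abs_le_of_periodic (g := schwarzianOne f)
    ((continuous_deriv_deriv h2).sub (((h2.continuous_deriv (by norm_num)).pow 2).div_const 2))
    (fun x => by simp only [schwarzianOne, hp, deriv_add_one_of_periodic hp])
  refine ⟨K * C, by positivity, fun n l x hl => ?_⟩
  have h3 : |schwarzian f l x| ≤ K * ∑ i ∈ Finset.range l, Real.exp (logDIter f i x) ^ 2 := by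
    rw [schwarzian_eq_sum hC hpos, Finset.mul_sum]
    refine (Finset.abs_sum_le_sum_abs _ _).trans (Finset.sum_le_sum fun i _ => ?_)
    rw [abs_mul, abs_pow, Real.abs_exp]
    exact mul_le_mul_of_nonneg_right (hK _) (by positivity)
  calc _ ≤ K * (∑ i ∈ Finset.range l, Real.exp (logDIter f i x) ^ 2) * beta f n x ^ 2 :=
        mul_le_mul_of_nonneg_right h3 (by positivity)
    _ ≤ K * C * bigM f n := by
        rw [mul_assoc, mul_assoc]; exact mul_le_mul_of_nonneg_left (h n l x hl) hK0.le

/-! ### The trace of the return map -/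

/-- For a Möbius transformation `g` this is the trace of the corresponding matrix in `SL(2, ℝ)`,
computed from the second order jet of `g` at `x`: with `φ = (g')^{-1/2}` it is
`φ + 1 / φ + (g - x) φ'`. Here `g = f^{q_n}`. -/
noncomputable def jetTrace (f : CircleDeg1Lift) (n : ℕ) (x : ℝ) : ℝ :=
  Real.exp (-logDIter f (q f.translationNumber n) x / 2) +
    Real.exp (logDIter f (q f.translationNumber n) x / 2) -
    (ret f n x - x) * deriv (logDIter f (q f.translationNumber n)) x / 2 *
      Real.exp (-logDIter f (q f.translationNumber n) x / 2)

theorem jetTrace_add_intCast (f : CircleDeg1Lift) (n : ℕ) (x : ℝ) (m : ℤ) :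
    jetTrace f n (x + m) = jetTrace f n x := by
  have hp : Function.Periodic (deriv (logDIter f (q f.translationNumber n))) 1 :=
    deriv_add_one_of_periodic (logDIter_add_one f _)
  have h : deriv (logDIter f (q f.translationNumber n)) (x + m) =
      deriv (logDIter f (q f.translationNumber n)) x := by simpa using hp.int_mul m x
  rw [jetTrace, jetTrace, logDIter_add_intCast, ret_add_intCast, h]
  ring

/-- The derivative of the trace is proportional to the Schwarzian derivative of the return map. -/
theorem hasDerivAt_jetTrace (hC : ContDiff ℝ 3 f) (hpos : ∀ x, 0 < deriv f x) (n : ℕ) (x : ℝ) :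
    HasDerivAt (jetTrace f n) (-(ret f n x - x) / 2 *
      Real.exp (-logDIter f (q f.translationNumber n) x / 2) *
      schwarzian f (q f.translationNumber n) x) x := by
  set v := logDIter f (q f.translationNumber n) with hv
  have hv2 : ContDiff ℝ 2 v := contDiff_two_logDIter hC hpos _
  have h1 := ((hv2.differentiable two_ne_zero) x).hasDerivAt
  have h2 := hasDerivAt_deriv hv2 x
  have h3 := hasDerivAt_ret (hC.differentiable three_ne_zero) hpos n x
  have h4 := (((h1.neg.div_const 2).exp).add ((h1.div_const 2).exp)).sub
    ((((h3.sub (hasDerivAt_id x)).mul h2).div_const 2).mul ((h1.neg.div_const 2).exp))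
  refine h4.congr_deriv ?_
  have e1 : Real.exp (v x) = Real.exp (v x / 2) * Real.exp (v x / 2) := by
    rw [← Real.exp_add]; ring_nf
  have e2 : Real.exp (v x / 2) * Real.exp (-v x / 2) = 1 := by
    rw [← Real.exp_add]; ring_nf; exact Real.exp_zero
  simp only [Pi.sub_apply, Pi.mul_apply, Pi.neg_apply, id, schwarzian, ← hv, e1]
  linear_combination (-(Real.exp (v x / 2) * deriv v x) / 2) * e2

/-- The trace is almost constant on the intervals `I_n(x)`, since its derivative is controlled by
the Schwarzian derivative. -/
theorem exists_jetTrace_sub_le (hf : Irrational f.translationNumber) (hC : ContDiff ℝ 3 f)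
    (hpos : ∀ x, 0 < deriv f x) : ∃ C, 0 < C ∧ ∀ (n : ℕ) (x y : ℝ), y ∈ uIcc x (ret f n x) →
      |jetTrace f n y - jetTrace f n x| ≤ C * bigM f n := by
  have hC2 : ContDiff ℝ 2 f := hC.of_le (by norm_num)
  obtain ⟨D, hD0, hD⟩ := exists_abs_logDIter_q_le hf hC2 hpos
  obtain ⟨K, hK0, hK⟩ := exists_abs_schwarzian_le hf hC hpos
  obtain ⟨B, hB0, hB⟩ := exists_beta_comparable hf hC2 hpos
  refine ⟨B * (Real.exp D * K), by positivity, fun n x y hy => ?_⟩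
  obtain ⟨ξ, hξ, h⟩ := exists_mem_uIcc_sub_eq (hasDerivAt_jetTrace hC hpos n) x y
  have hξ' : ξ ∈ uIcc x (ret f n x) := uIcc_subset_uIcc_left hy hξ
  have hb := beta_pos hf n ξ
  have hyx : |y - x| ≤ B * beta f n ξ := by
    have := abs_iterate_sub_le_beta n 0 hy
    exact this.trans (hB n x ξ hξ').2
  have hexp : Real.exp (-logDIter f (q f.translationNumber n) ξ / 2) ≤ Real.exp D :=
    Real.exp_le_exp.2 (by have := abs_le.1 (hD n ξ); linarith)
  have hS := hK n (q f.translationNumber n) ξ (by have := q_le_succ hf n; omega)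
  rw [h, abs_mul, abs_mul, abs_mul, Real.abs_exp, abs_div, abs_neg, ← beta_eq_abs, abs_two]
  calc beta f n ξ / 2 * Real.exp (-logDIter f (q f.translationNumber n) ξ / 2) *
        |schwarzian f (q f.translationNumber n) ξ| * |y - x|
      ≤ beta f n ξ * Real.exp D * |schwarzian f (q f.translationNumber n) ξ| *
        (B * beta f n ξ) := by
        gcongr
        linarith
    _ = B * (Real.exp D * (|schwarzian f (q f.translationNumber n) ξ| * beta f n ξ ^ 2)) := by
        ring
    _ ≤ B * (Real.exp D * (K * bigM f n)) := by gcongr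
    _ = _ := by ring

/-- The function `(f')^{-1/2}`, which is affine when `f` is a Möbius transformation. -/
noncomputable def invSqrtD (f : CircleDeg1Lift) (x : ℝ) : ℝ := Real.exp (-logD f x / 2)

theorem hasDerivAt_invSqrtD (hC : ContDiff ℝ 2 f) (hpos : ∀ x, 0 < deriv f x) (x : ℝ) :
    HasDerivAt (invSqrtD f) (-deriv (logD f) x / 2 * invSqrtD f x) x := by
  have h1 : ContDiff ℝ 1 (logD f) := contDiff_logD (k := 1) (by exact_mod_cast hC) hpos
  have h2 := ((((h1.differentiable one_ne_zero) x).hasDerivAt.neg.div_const 2).exp)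
  refine h2.congr_deriv ?_
  simp only [Pi.neg_apply, invSqrtD]
  ring

theorem contDiff_invSqrtD (hC : ContDiff ℝ 3 f) (hpos : ∀ x, 0 < deriv f x) :
    ContDiff ℝ 2 (invSqrtD f) :=
  ((contDiff_two_logD hC hpos).neg.div_const 2).exp

theorem invSqrtD_pos (x : ℝ) : 0 < invSqrtD f x := Real.exp_pos _

theorem exp_logD_eq (x : ℝ) : Real.exp (logD f x) = (invSqrtD f x ^ 2)⁻¹ := by
  rw [invSqrtD, ← Real.exp_nat_mul, ← Real.exp_neg]; push_cast; ring_nf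

theorem abs_taylor_one_le {g : ℝ → ℝ} (hg : ContDiff ℝ 2 g) {K : ℝ}
    (hK : ∀ x, |deriv (deriv g) x| ≤ K) (x y : ℝ) :
    |g y - g x - (y - x) * deriv g x| ≤ K * |y - x| ^ 2 := by
  obtain ⟨ξ, hξ, h⟩ := exists_mem_uIcc_sub_eq
    (fun z => ((hg.differentiable two_ne_zero) z).hasDerivAt) x y
  obtain ⟨η, -, h'⟩ := exists_mem_uIcc_sub_eq (hasDerivAt_deriv hg) x ξ
  have : g y - g x - (y - x) * deriv g x = deriv (deriv g) η * (ξ - x) * (y - x) := by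
    rw [h, ← h']; ring
  rw [this, abs_mul, abs_mul, sq, ← mul_assoc]
  have h1 := abs_sub_left_of_mem_uIcc hξ
  have h2 := (abs_nonneg _).trans (hK η)
  gcongr
  exact hK η

/-- A diffeomorphism with `Φ = (f')^{-1/2}` satisfies `(f y - f x) Φ(x) Φ(y) = y - x` up to the
third order; equality holds for Möbius transformations. -/
theorem exists_abs_sub_mul_invSqrtD_le (hC : ContDiff ℝ 3 f) (hpos : ∀ x, 0 < deriv f x) :
    ∃ K, 0 < K ∧ ∀ x y, |(f y - f x) * invSqrtD f x * invSqrtD f y - (y - x)| ≤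
      K * |y - x| ^ 3 := by
  have hC2 : ContDiff ℝ 2 f := hC.of_le (by norm_num)
  have hΦ := contDiff_invSqrtD hC hpos
  have hp : ∀ x, invSqrtD f (x + 1) = invSqrtD f x := fun x => by
    rw [invSqrtD, invSqrtD, logD_add_one]
  obtain ⟨K0, hK00, hK0⟩ := exists_abs_le_of_periodic hΦ.continuous hp
  obtain ⟨K2, hK20, hK2⟩ := exists_abs_le_of_periodic (continuous_deriv_deriv hΦ)
    (deriv_add_one_of_periodic (deriv_add_one_of_periodic hp))
  obtain ⟨K1, hK10, hK1⟩ := exists_abs_le_of_periodic (hC2.continuous_deriv (by norm_num))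
    (deriv_add_one f)
  have hd : ∀ z, HasDerivAt f (deriv f z) z :=
    fun z => ((hC.differentiable three_ne_zero) z).hasDerivAt
  have hd' : ∀ z, deriv f z = (invSqrtD f z ^ 2)⁻¹ := fun z => by
    rw [← exp_logD_eq, logD, Real.exp_log (hpos z)]
  refine ⟨K1 * K0 * K2, by positivity, fun x y => ?_⟩
  set Φ := invSqrtD f with hΦdef
  have hΦd : ∀ z, HasDerivAt Φ (deriv Φ z) z :=
    fun z => ((hΦ.differentiable two_ne_zero) z).hasDerivAt
  have hE : ∀ z, HasDerivAt (fun z => (f z - f x) * Φ x * Φ z - (z - x))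
      (Φ x / Φ z + (f z - f x) * Φ x * deriv Φ z - 1) z := by
    intro z
    have h := (((((hd z).sub_const (f x)).mul_const (Φ x)).mul (hΦd z)).sub
      ((hasDerivAt_id z).sub_const x))
    refine h.congr_deriv ?_
    have : Φ z ≠ 0 := (invSqrtD_pos z).ne'
    rw [hd']
    field_simp
  have hE' : ∀ z, HasDerivAt (fun z => Φ x / Φ z + (f z - f x) * Φ x * deriv Φ z - 1)
      ((f z - f x) * Φ x * deriv (deriv Φ) z) z := by
    intro z
    have hz : Φ z ≠ 0 := (invSqrtD_pos z).ne'
    have h := ((((hΦd z).inv hz).const_mul (Φ x)).add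
      ((((hd z).sub_const (f x)).mul_const (Φ x)).mul (hasDerivAt_deriv hΦ z))).sub_const 1
    refine h.congr_deriv ?_
    rw [hd']
    field_simp
    ring
  obtain ⟨ξ, hξ, h1⟩ := exists_mem_uIcc_sub_eq hE x y
  obtain ⟨η, hη, h2⟩ := exists_mem_uIcc_sub_eq hE' x ξ
  obtain ⟨ζ, -, h3⟩ := exists_mem_uIcc_sub_eq hd x η
  have hx : Φ x ≠ 0 := (invSqrtD_pos x).ne'
  simp only [sub_self, zero_mul, div_self hx, sub_zero, add_zero] at h1 h2
  have b1 := abs_sub_left_of_mem_uIcc hξ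
  have b2 := (abs_sub_left_of_mem_uIcc hη).trans b1
  rw [h1, h2, h3]
  simp only [abs_mul]
  calc |deriv f ζ| * |η - x| * |Φ x| * |deriv (deriv Φ) η| * |ξ - x| * |y - x|
      ≤ K1 * |y - x| * K0 * K2 * |y - x| * |y - x| := by
        gcongr
        · exact hK1 _
        · exact hK0 _
        · exact hK2 _
    _ = _ := by ring

/-! ### First order estimates -/

theorem logDIter_one (x : ℝ) : logDIter f 1 x = logD f x := by simp [logDIter]

/-- The trace of the return map is almost invariant under `f`. -/
theorem exists_abs_jetTrace_map_sub_le (hf : Irrational f.translationNumber) (hC : ContDiff ℝ 3 f)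
    (hpos : ∀ x, 0 < deriv f x) : ∃ C, 0 < C ∧ ∀ (n : ℕ) (x : ℝ),
      |jetTrace f n (f x) - jetTrace f n x| ≤ C * beta f n x ^ 2 := by
  have hC2 : ContDiff ℝ 2 f := hC.of_le (by norm_num)
  have hΦ := contDiff_invSqrtD hC hpos
  have hp : ∀ x, invSqrtD f (x + 1) = invSqrtD f x := fun x => by
    rw [invSqrtD, invSqrtD, logD_add_one]
  obtain ⟨K0, hK00, hK0⟩ := exists_abs_le_of_periodic (hΦ.continuous.inv₀
    fun x => (invSqrtD_pos x).ne') (fun x => by simp only [Pi.inv_apply, hp])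
  obtain ⟨K1, hK10, hK1⟩ := exists_abs_le_of_periodic (hΦ.continuous_deriv (by norm_num))
    (deriv_add_one_of_periodic hp)
  obtain ⟨K2, hK20, hK2⟩ := exists_abs_le_of_periodic (continuous_deriv_deriv hΦ)
    (deriv_add_one_of_periodic (deriv_add_one_of_periodic hp))
  obtain ⟨K3, hK30, hK3⟩ := exists_abs_sub_mul_invSqrtD_le hC hpos
  obtain ⟨D, hD0, hD⟩ := exists_abs_logDIter_q_le hf hC2 hpos
  obtain ⟨A, hA0, hA⟩ := exists_abs_deriv_logDIter_le hf hC2 hpos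
  refine ⟨K3 * (A * Real.exp D) + 2 * (Real.exp D * K0 * (K2 + K3 * K1)), by positivity,
    fun n x => ?_⟩
  set Q := q f.translationNumber n with hQ
  set v := logDIter f Q with hv
  set Φ := invSqrtD f with hΦdef
  set y := ret f n x with hy
  obtain ⟨e, he⟩ : ∃ e, e = (f y - f x) * Φ x * Φ y - (y - x) := ⟨_, rfl⟩
  have hd : |y - x| = beta f n x := (beta_eq_abs f n x).symm
  have hd1 : beta f n x ≤ 1 := (beta_lt_one hf n x).le
  have hd0 : 0 < beta f n x := beta_pos hf n x
  have he3 : |e| ≤ K3 * beta f n x ^ 3 := by rw [he, ← hd]; exact hK3 x y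
  have he2 : |e| ≤ K3 * beta f n x ^ 2 :=
    he3.trans (mul_le_mul_of_nonneg_left (pow_le_pow_of_le_one hd0.le hd1 (by norm_num)) hK30.le)
  have hΦx : 0 < Φ x := invSqrtD_pos x
  have hΦy : 0 < Φ y := invSqrtD_pos y
  -- The jets of the return map at `x` and `f x` are related by the chain rule.
  have hvf : v (f x) = v x + logD f y - logD f x := by
    have := logDIter_q_iterate f 1 n x
    rwa [logDIter_one, logDIter_one] at this
  have hret : ret f n (f x) = f y := ret_iterate f n 1 x
  have hvd : ∀ z, HasDerivAt v (deriv v z) z :=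
    fun z => (((contDiff_two_logDIter hC hpos Q).differentiable two_ne_zero) z).hasDerivAt
  have hld : ∀ z, HasDerivAt (logD f) (deriv (logD f) z) z :=
    fun z => (((contDiff_two_logD hC hpos).differentiable two_ne_zero) z).hasDerivAt
  have hfd : ∀ z, HasDerivAt f (Φ z ^ 2)⁻¹ z := fun z => by
    rw [← exp_logD_eq, logD, Real.exp_log (hpos z)]
    exact ((hC.differentiable three_ne_zero) z).hasDerivAt
  have hvf' : deriv v (f x) * (Φ x ^ 2)⁻¹ =
      deriv v x + deriv (logD f) y * Real.exp (v x) - deriv (logD f) x := by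
    have h1 := (hvd (f x)).comp x (hfd x)
    have h2 : HasDerivAt (v ∘ f) (deriv v x + deriv (logD f) y * Real.exp (v x)
        - deriv (logD f) x) x := by
      have h3 : v ∘ f = fun z => v z + logD f (ret f n z) - logD f z := by
        ext z
        have := logDIter_q_iterate f 1 n z
        rwa [logDIter_one, logDIter_one] at this
      rw [h3]
      exact ((hvd x).add ((hld y).comp x
        (hasDerivAt_ret (hC.differentiable three_ne_zero) hpos n x))).sub (hld x)
    exact h1.unique h2
  have hΦ' : ∀ z, deriv Φ z = -deriv (logD f) z / 2 * Φ z :=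
    fun z => (hasDerivAt_invSqrtD hC2 hpos z).deriv
  have hld' : ∀ z, deriv (logD f) z = -2 * (deriv Φ z / Φ z) := fun z => by
    have : Φ z ≠ 0 := (invSqrtD_pos z).ne'
    rw [hΦ']; field_simp
  set φ := Real.exp (-v x / 2) with hφ
  have hφ0 : 0 < φ := Real.exp_pos _
  have hφi : Real.exp (v x / 2) = φ⁻¹ := by rw [hφ, ← Real.exp_neg]; ring_nf
  have hφ2 : Real.exp (v x) = (φ ^ 2)⁻¹ := by
    rw [hφ, ← Real.exp_nat_mul, ← Real.exp_neg]; push_cast; ring_nf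
  have hφ1 : Real.exp (-v (f x) / 2) = Φ y * φ / Φ x := by
    rw [hvf, hφ, hΦdef, invSqrtD, invSqrtD, ← Real.exp_add, ← Real.exp_sub]; ring_nf
  have hφ1i : Real.exp (v (f x) / 2) = Φ x / (Φ y * φ) := by
    rw [← inv_div (Φ y * φ), ← hφ1, ← Real.exp_neg, neg_div, neg_neg]
  have hvf'' : deriv v (f x) = Φ x ^ 2 * (deriv v x - 2 * (deriv Φ y / Φ y) * (φ ^ 2)⁻¹ +
      2 * (deriv Φ x / Φ x)) := by
    rw [← hφ2]
    rw [hld' y, hld' x] at hvf'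
    have : Φ x ^ 2 * (Φ x ^ 2)⁻¹ = 1 := mul_inv_cancel₀ (by positivity)
    linear_combination (Φ x ^ 2) * hvf' - deriv v (f x) * this
  have hmain : jetTrace f n (f x) - jetTrace f n x =
      e * (-(deriv v x) / 2 * φ)
      + φ * (Φ x)⁻¹ * ((Φ y - Φ x - (y - x) * deriv Φ x) - e * deriv Φ x)
      + φ⁻¹ * (Φ y)⁻¹ * ((Φ x - Φ y - (x - y) * deriv Φ y) + e * deriv Φ y) := by
    have hfy : f y - f x = (e + (y - x)) / (Φ x * Φ y) := by
      rw [he]; field_simp; ring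
    rw [jetTrace, jetTrace, hret, ← hQ, ← hv, ← hy, hφ1, hφ1i, hφi, hvf'', hfy, ← hφ]
    field_simp
    ring
  have hT1 := abs_taylor_one_le hΦ hK2 x y
  have hT2 := abs_taylor_one_le hΦ hK2 y x
  rw [abs_sub_comm x y] at hT2
  rw [hd] at hT1 hT2
  have hvb := abs_le.1 (hD n x)
  have hφb : φ ≤ Real.exp D := Real.exp_le_exp.2 (by linarith)
  have hφib : φ⁻¹ ≤ Real.exp D := by rw [← hφi]; exact Real.exp_le_exp.2 (by linarith)
  have hAx := hA n Q x (by have := q_le_succ hf n; omega)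
  have hΦxb : (Φ x)⁻¹ ≤ K0 := (le_abs_self _).trans (hK0 x)
  have hΦyb : (Φ y)⁻¹ ≤ K0 := (le_abs_self _).trans (hK0 y)
  have t1 : |e * (-(deriv v x) / 2 * φ)| ≤ K3 * (A * Real.exp D) * beta f n x ^ 2 := by
    rw [abs_mul, abs_mul, abs_div, abs_neg, abs_two, abs_of_pos hφ0]
    calc |e| * (|deriv v x| / 2 * φ)
        ≤ K3 * beta f n x ^ 3 * (|deriv v x| * Real.exp D) := by
          gcongr
          linarith [abs_nonneg (deriv v x)]
      _ = K3 * beta f n x ^ 2 * ((|deriv v x| * beta f n x) * Real.exp D) := by ring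
      _ ≤ K3 * beta f n x ^ 2 * (A * Real.exp D) := by gcongr
      _ = _ := by ring
  have hb : ∀ z, |e * deriv Φ z| ≤ K3 * K1 * beta f n x ^ 2 := fun z => by
    rw [abs_mul]
    calc |e| * |deriv Φ z| ≤ (K3 * beta f n x ^ 2) * K1 := by
          gcongr; exact hK1 z
      _ = _ := by ring
  have t2 : |φ * (Φ x)⁻¹ * ((Φ y - Φ x - (y - x) * deriv Φ x) - e * deriv Φ x)| ≤
      Real.exp D * K0 * (K2 + K3 * K1) * beta f n x ^ 2 := by
    rw [abs_mul, abs_of_pos (by positivity : 0 < φ * (Φ x)⁻¹), mul_assoc _ (K2 + _)]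
    have := (abs_sub _ _).trans (add_le_add hT1 (hb x))
    gcongr
    linarith
  have t3 : |φ⁻¹ * (Φ y)⁻¹ * ((Φ x - Φ y - (x - y) * deriv Φ y) + e * deriv Φ y)| ≤
      Real.exp D * K0 * (K2 + K3 * K1) * beta f n x ^ 2 := by
    rw [abs_mul, abs_of_pos (by positivity : 0 < φ⁻¹ * (Φ y)⁻¹), mul_assoc _ (K2 + _)]
    have := (abs_add_le _ _).trans (add_le_add hT2 (hb y))
    gcongr
    linarith
  rw [hmain]
  refine (abs_add_three _ _ _).trans ?_
  linarith

/-- The trace is at most two at a point where `β_n` is minimal. -/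
theorem jetTrace_le_two_of_isMin (hf : Irrational f.translationNumber) (hC : ContDiff ℝ 3 f)
    (hpos : ∀ x, 0 < deriv f x) {n : ℕ} {x₀ : ℝ} (h : ∀ x, beta f n x₀ ≤ beta f n x) :
    jetTrace f n x₀ ≤ 2 := by
  have hd : Differentiable ℝ f := hC.differentiable three_ne_zero
  have h0 := logDIter_eq_zero_of_isMin hf hd hpos h
  set v := logDIter f (q f.translationNumber n) with hv
  have hvd : HasDerivAt v (deriv v x₀) x₀ :=
    (((contDiff_two_logDIter hC hpos _).differentiable two_ne_zero) x₀).hasDerivAt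
  have hdb : deriv (beta f n) = fun x => (-1) ^ n * (Real.exp (v x) - 1) :=
    funext fun x => (hasDerivAt_beta hf hd hpos n x).deriv
  have hddb : deriv (deriv (beta f n)) x₀ = (-1) ^ n * deriv v x₀ := by
    rw [hdb]
    have := ((hvd.exp.sub_const 1).const_mul ((-1 : ℝ) ^ n)).deriv
    rw [h0, Real.exp_zero, one_mul] at this
    exact this
  have hnn : 0 ≤ deriv (deriv (beta f n)) x₀ := by
    by_contra! hneg
    have hmax := isLocalMax_of_deriv_deriv_neg hneg (by rw [hdb]; simp [h0])
      (continuous_beta hf hd hpos n).continuousAt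
    have hconst : beta f n =ᶠ[nhds x₀] fun _ => beta f n x₀ := by
      filter_upwards [hmax] with x hx
      exact le_antisymm hx (h x)
    have h1 := hconst.deriv.deriv_eq
    simp only [deriv_const'] at h1
    linarith
  have hb := beta_pos hf n x₀
  rw [hddb] at hnn
  rw [beta_eq_mul hf] at hb
  have hprod : 0 ≤ (ret f n x₀ - x₀) * deriv v x₀ := by
    rcases neg_one_pow_eq_or ℝ n with hn | hn <;> rw [hn] at hnn hb <;> nlinarith
  rw [jetTrace, ← hv, h0]
  simp only [neg_zero, zero_div, Real.exp_zero, mul_one]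
  linarith

/-- Starting from a fundamental interval at a minimum of `β_n`, every point of the circle is
reached by at most `2 q_{n+1}` iterations, during which the trace changes by `O(M_n)`. -/
theorem exists_jetTrace_le (hf : Irrational f.translationNumber) (hC : ContDiff ℝ 3 f)
    (hpos : ∀ x, 0 < deriv f x) : ∃ C, 0 < C ∧ ∀ (n : ℕ) (x : ℝ),
      jetTrace f n x ≤ 2 + C * bigM f n := by
  obtain ⟨A, hA0, hA⟩ := exists_jetTrace_sub_le hf hC hpos
  obtain ⟨B, hB0, hB⟩ := exists_abs_jetTrace_map_sub_le hf hC hpos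
  refine ⟨A + B * 4, by positivity, fun n x => ?_⟩
  obtain ⟨x₀, hx₀⟩ := exists_forall_le_of_periodic
    (continuous_beta hf (hC.differentiable three_ne_zero) hpos n)
    (fun x => by simpa using beta_add_intCast f n x 1)
  obtain ⟨l, hl, m, y, hy, rfl⟩ := exists_iterate_mem hf hC.continuous n x₀ x
  have h1 := (abs_le.1 (hA n x₀ y hy)).2
  have h2 := jetTrace_le_two_of_isMin hf hC hpos hx₀
  have h3 : ∀ l, jetTrace f n (f^[l] y) - jetTrace f n y ≤
      B * ∑ i ∈ Finset.range l, beta f n (f^[i] y) ^ 2 := by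
    intro l
    induction l with
    | zero => simp
    | succ l ih =>
      rw [Finset.sum_range_succ, Function.iterate_succ_apply', mul_add]
      have := (abs_le.1 (hB n (f^[l] y))).2
      linarith
  have h4 := mul_le_mul_of_nonneg_left (sum_beta_sq_le hf n y hl.le) hB0.le
  rw [jetTrace_add_intCast]
  linarith [h3 l]

theorem two_add_sq_le_exp_add_exp_neg (t : ℝ) : 2 + t ^ 2 / 2 ≤ Real.exp (-t) + Real.exp t := by
  rcases le_total 0 t with h | h
  · have h1 := Real.quadratic_le_exp_of_nonneg h
    have h2 := Real.add_one_le_exp (-t)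
    linarith
  · have h1 := Real.quadratic_le_exp_of_nonneg (neg_nonneg.2 h)
    have h2 := Real.add_one_le_exp t
    linarith [neg_sq t]

/-- The return map `f^{q_n}` is `O(M_n^{1/2})`-close to an isometry: at the extrema of
`log (f^{q_n})'` the trace is `2 cosh (log (f^{q_n})' / 2)`. -/
theorem exists_abs_logDIter_q_le_sqrt (hf : Irrational f.translationNumber) (hC : ContDiff ℝ 3 f)
    (hpos : ∀ x, 0 < deriv f x) : ∃ C, 0 < C ∧ ∀ (n : ℕ) (x : ℝ),
      |logDIter f (q f.translationNumber n) x| ≤ C * √(bigM f n) := by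
  obtain ⟨A, hA0, hA⟩ := exists_jetTrace_le hf hC hpos
  refine ⟨√(8 * A), by positivity, fun n x => ?_⟩
  have hc : Continuous (logDIter f (q f.translationNumber n)) :=
    (contDiff_two_logDIter hC hpos _).continuous
  have key : ∀ z, deriv (logDIter f (q f.translationNumber n)) z = 0 →
      |logDIter f (q f.translationNumber n) z| ≤ √(8 * A) * √(bigM f n) := by
    intro z hz
    have h1 := hA n z
    rw [jetTrace, hz, neg_div] at h1
    have h2 := two_add_sq_le_exp_add_exp_neg (logDIter f (q f.translationNumber n) z / 2)
    rw [← Real.sqrt_mul (by positivity)]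
    apply Real.abs_le_sqrt
    linarith
  obtain ⟨a, ha⟩ := exists_forall_le_of_periodic hc (logDIter_add_one f _)
  obtain ⟨b, hb⟩ := exists_forall_ge_of_periodic hc (logDIter_add_one f _)
  have h1 := key a (IsLocalMin.deriv_eq_zero (Eventually.of_forall ha))
  have h2 := key b (IsLocalMax.deriv_eq_zero (Eventually.of_forall hb))
  rw [abs_le] at h1 h2 ⊢
  exact ⟨h1.1.trans (ha x), (hb x).trans h2.2⟩

theorem abs_exp_sub_one_le {t D : ℝ} (h : |t| ≤ D) : |Real.exp t - 1| ≤ Real.exp D * |t| := by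
  obtain ⟨ξ, hξ, he⟩ := exists_mem_uIcc_sub_eq Real.hasDerivAt_exp 0 t
  rw [Real.exp_zero, sub_zero] at he
  rw [he, abs_mul, Real.abs_exp]
  have h1 := abs_sub_left_of_mem_uIcc hξ
  rw [sub_zero, sub_zero] at h1
  gcongr
  exact (le_abs_self ξ).trans (h1.trans h)

theorem exists_abs_exp_logDIter_q_sub_one_le (hf : Irrational f.translationNumber)
    (hC : ContDiff ℝ 3 f) (hpos : ∀ x, 0 < deriv f x) : ∃ C, 0 < C ∧ ∀ (n : ℕ) (x : ℝ),
      |Real.exp (logDIter f (q f.translationNumber n) x) - 1| ≤ C * √(bigM f n) := by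
  obtain ⟨A, hA0, hA⟩ := exists_abs_logDIter_q_le_sqrt hf hC hpos
  obtain ⟨D, hD0, hD⟩ := exists_abs_logDIter_q_le hf (hC.of_le (by norm_num)) hpos
  refine ⟨Real.exp D * A, by positivity, fun n x => (abs_exp_sub_one_le (hD n x)).trans ?_⟩
  rw [mul_assoc]
  exact mul_le_mul_of_nonneg_left (hA n x) (Real.exp_pos D).le

/-- The nonlinearity of `f^l`, `l ≤ 2 q_{n+1}`, is at most `C M_n^{1/2} / β_n(x)`. At an extremum of
`β_n · (log (f^l)')'` this follows from the bounds on the Schwarzian derivative of `f^l` and on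
the derivative of `β_n`. -/
theorem exists_abs_deriv_logDIter_le_sqrt (hf : Irrational f.translationNumber)
    (hC : ContDiff ℝ 3 f) (hpos : ∀ x, 0 < deriv f x) : ∃ C, 0 < C ∧ ∀ (n l : ℕ) (x : ℝ),
      l ≤ 2 * q f.translationNumber (n + 1) →
        |deriv (logDIter f l) x| * beta f n x ≤ C * √(bigM f n) := by
  obtain ⟨A, hA0, hA⟩ := exists_abs_exp_logDIter_q_sub_one_le hf hC hpos
  obtain ⟨S, hS0, hS⟩ := exists_abs_schwarzian_le hf hC hpos
  have hd : Differentiable ℝ f := hC.differentiable three_ne_zero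
  refine ⟨√(4 * A ^ 2 + 4 * S), by positivity, fun n l x hl => ?_⟩
  have hu := contDiff_two_logDIter hC hpos l
  set N := deriv (logDIter f l) with hN
  have hM := bigM_pos hf n
  have hM2 : √(bigM f n) ^ 2 = bigM f n := Real.sq_sqrt hM.le
  have hder : ∀ z, HasDerivAt (fun z => beta f n z * N z)
      ((-1) ^ n * (Real.exp (logDIter f (q f.translationNumber n) z) - 1) * N z +
        beta f n z * deriv N z) z := fun z =>
    (hasDerivAt_beta hf hd hpos n z).mul (hasDerivAt_deriv hu z)
  have hc : Continuous (fun z => beta f n z * N z) :=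
    (continuous_beta hf hd hpos n).mul (hu.continuous_deriv (by norm_num))
  have hper : ∀ z, beta f n (z + 1) * N (z + 1) = beta f n z * N z := fun z => by
    have := beta_add_intCast f n z 1
    rw [Int.cast_one] at this
    rw [this, hN, deriv_add_one_of_periodic (logDIter_add_one f l)]
  have key : ∀ z, (-1) ^ n * (Real.exp (logDIter f (q f.translationNumber n) z) - 1) * N z +
      beta f n z * deriv N z = 0 → |beta f n z * N z| ≤ √(4 * A ^ 2 + 4 * S) * √(bigM f n) := by
    intro z hz
    set E := (-1) ^ n * (Real.exp (logDIter f (q f.translationNumber n) z) - 1) with hE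
    have hEb : |E| ≤ A * √(bigM f n) := by
      rw [hE, abs_mul, abs_pow, abs_neg, abs_one, one_pow, one_mul]; exact hA n z
    have hSz := hS n l z hl
    have hs : schwarzian f l z = deriv N z - N z ^ 2 / 2 := rfl
    set ψ := beta f n z * N z with hψ
    have h1 : ψ ^ 2 / 2 = -(E * ψ) - schwarzian f l z * beta f n z ^ 2 := by
      rw [hs, hψ]; linear_combination beta f n z * hz
    have h2 : |E * ψ| ≤ A * √(bigM f n) * |ψ| := by rw [abs_mul]; gcongr
    have h3 : |schwarzian f l z * beta f n z ^ 2| ≤ S * bigM f n := by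
      rw [abs_mul, abs_of_nonneg (a := beta f n z ^ 2) (by positivity)]; exact hSz
    have h4 : ψ ^ 2 / 2 ≤ A * √(bigM f n) * |ψ| + S * bigM f n := by
      linarith [(abs_le.1 h2).1, (abs_le.1 h3).1]
    rw [← Real.sqrt_mul (by positivity)]
    apply Real.abs_le_sqrt
    nlinarith [sq_nonneg (|ψ| - 2 * A * √(bigM f n)), sq_abs ψ]
  obtain ⟨a, ha⟩ := exists_forall_le_of_periodic hc hper
  obtain ⟨b, hb⟩ := exists_forall_ge_of_periodic hc hper
  have h1 := key a (IsLocalMin.hasDerivAt_eq_zero (Eventually.of_forall ha) (hder a))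
  have h2 := key b (IsLocalMax.hasDerivAt_eq_zero (Eventually.of_forall hb) (hder b))
  have hb0 := beta_pos hf n x
  have h3 : |N x| * beta f n x = |beta f n x * N x| := by rw [abs_mul, abs_of_pos hb0, mul_comm]
  rw [h3]
  rw [abs_le] at h1 h2 ⊢
  exact ⟨h1.1.trans (ha x), (hb x).trans h2.2⟩

/-! ### Derivatives of higher order -/

/-- The scale `M_n^{1/2} / β_n(x)` which measures the derivatives of the iterates at `x`. -/
noncomputable def scale (f : CircleDeg1Lift) (n : ℕ) (x : ℝ) : ℝ := √(bigM f n) / beta f n x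

theorem scale_pos (hf : Irrational f.translationNumber) (n : ℕ) (x : ℝ) : 0 < scale f n x :=
  div_pos (Real.sqrt_pos.2 (bigM_pos hf n)) (beta_pos hf n x)

theorem contDiff_deriv {g : ℝ → ℝ} {k : ℕ} (h : ContDiff ℝ (k + 1 : ℕ) g) :
    ContDiff ℝ k (deriv g) := by
  have h1 : ContDiff ℝ ((k : WithTop ℕ∞) + 1) g := by exact_mod_cast h
  exact (contDiff_succ_iff_deriv.1 h1).2.2

theorem iteratedDeriv_add_one_of_periodic {g : ℝ → ℝ} (hp : ∀ x, g (x + 1) = g x) (n : ℕ) (x : ℝ) :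
    iteratedDeriv n g (x + 1) = iteratedDeriv n g x := by
  induction n generalizing x with
  | zero => simpa using hp x
  | succ n ih => rw [iteratedDeriv_succ]; exact deriv_add_one_of_periodic ih x

theorem abs_iteratedDeriv_comp_le {g h : ℝ → ℝ} {n : ℕ} (hg : ContDiff ℝ n g)
    (hh : ContDiff ℝ n h) (x : ℝ) {C D : ℝ} (hC : ∀ i ≤ n, |iteratedDeriv i g (h x)| ≤ C)
    (hD : ∀ i, 1 ≤ i → i ≤ n → |iteratedDeriv i h x| ≤ D ^ i) :
    |iteratedDeriv n (fun y => g (h y)) x| ≤ n.factorial * C * D ^ n := by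
  have := norm_iteratedFDeriv_comp_le hg hh le_rfl x (C := C) (D := D)
    (fun i hi => by rw [norm_iteratedFDeriv_eq_norm_iteratedDeriv]; exact hC i hi)
    (fun i h1 hi => by rw [norm_iteratedFDeriv_eq_norm_iteratedDeriv]; exact hD i h1 hi)
  rwa [norm_iteratedFDeriv_eq_norm_iteratedDeriv] at this

theorem abs_iteratedDeriv_exp_comp_le {h : ℝ → ℝ} {n : ℕ} (hh : ContDiff ℝ n h) (x : ℝ) {D : ℝ}
    (hD : ∀ i, 1 ≤ i → i ≤ n → |iteratedDeriv i h x| ≤ D ^ i) :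
    |iteratedDeriv n (fun y => Real.exp (h y)) x| ≤ n.factorial * Real.exp (h x) * D ^ n :=
  abs_iteratedDeriv_comp_le Real.contDiff_exp hh x
    (fun i _ => by rw [iteratedDeriv_eq_iterate, Real.iter_deriv_exp, Real.abs_exp]) hD

theorem abs_iteratedDeriv_mul_le {a b : ℝ → ℝ} {n : ℕ} (ha : ContDiff ℝ n a)
    (hb : ContDiff ℝ n b) (x : ℝ) {A B w : ℝ} (hw : 0 ≤ w)
    (hA : ∀ i ≤ n, |iteratedDeriv i a x| ≤ A * w ^ i)
    (hB : ∀ i ≤ n, |iteratedDeriv i b x| ≤ B * w ^ i) :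
    |iteratedDeriv n (fun y => a y * b y) x| ≤ 2 ^ n * (A * B) * w ^ n := by
  have h := norm_iteratedFDeriv_mul_le ha hb x (n := n) le_rfl
  simp only [norm_iteratedFDeriv_eq_norm_iteratedDeriv] at h
  refine h.trans ?_
  have hA0 : 0 ≤ A := by simpa using (abs_nonneg _).trans (hA 0 (Nat.zero_le _))
  calc ∑ i ∈ Finset.range (n + 1), (n.choose i : ℝ) * ‖iteratedDeriv i a x‖ *
        ‖iteratedDeriv (n - i) b x‖
      ≤ ∑ i ∈ Finset.range (n + 1), (n.choose i : ℝ) * (A * B * w ^ n) := by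
        refine Finset.sum_le_sum fun i hi => ?_
        have hi : i ≤ n := by simpa [Nat.lt_succ_iff] using hi
        rw [mul_assoc]
        refine mul_le_mul_of_nonneg_left ?_ (by positivity)
        calc ‖iteratedDeriv i a x‖ * ‖iteratedDeriv (n - i) b x‖
            ≤ (A * w ^ i) * (B * w ^ (n - i)) :=
              mul_le_mul (hA i hi) (hB _ (Nat.sub_le _ _)) (norm_nonneg _) (by positivity)
          _ = A * B * (w ^ i * w ^ (n - i)) := by ring
          _ = A * B * w ^ n := by rw [← pow_add, Nat.add_sub_cancel' hi]
    _ = 2 ^ n * (A * B) * w ^ n := by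
        rw [← Finset.sum_mul, ← Nat.cast_sum, Nat.sum_range_choose]; push_cast; ring

theorem exists_exp_logDIter_le_scale (hf : Irrational f.translationNumber) (hC : ContDiff ℝ 2 f)
    (hpos : ∀ x, 0 < deriv f x) : ∃ C, 1 ≤ C ∧ ∀ (n l : ℕ) (x : ℝ),
      l ≤ 2 * q f.translationNumber (n + 1) → Real.exp (logDIter f l x) ≤ C * scale f n x := by
  obtain ⟨C, hC0, h⟩ := exists_exp_mul_beta_le hf hC hpos
  refine ⟨C + 1, by linarith, fun n l x hl => ?_⟩
  have hb := beta_pos hf n x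
  have hM := bigM_pos hf n
  have h1 : bigM f n ≤ √(bigM f n) := Real.le_sqrt_of_sq_le (by
    have := bigM_le_one hf n; nlinarith)
  rw [scale, ← mul_div_assoc, le_div_iff₀ hb]
  refine (h n l x hl).trans ?_
  have h2 := (beta_le_bigM hf n (f^[l] x)).trans h1
  have := mul_le_mul_of_nonneg_left h2 hC0.le
  linarith [Real.sqrt_nonneg (bigM f n)]

theorem exists_sum_exp_sq_le_scale (hf : Irrational f.translationNumber) (hC : ContDiff ℝ 2 f)
    (hpos : ∀ x, 0 < deriv f x) : ∃ C, 0 < C ∧ ∀ (n l : ℕ) (x : ℝ),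
      l ≤ 2 * q f.translationNumber (n + 1) →
        ∑ i ∈ Finset.range l, Real.exp (logDIter f i x) ^ 2 ≤ C * scale f n x ^ 2 := by
  obtain ⟨C, hC0, h⟩ := exists_sum_exp_sq_le hf hC hpos
  refine ⟨C, hC0, fun n l x hl => ?_⟩
  have hb := beta_pos hf n x
  rw [scale, div_pow, Real.sq_sqrt (bigM_pos hf n).le, ← mul_div_assoc, le_div_iff₀ (by positivity)]
  exact h n l x hl

/-- The derivatives of the map `f^i`, given those of `log (f^i)'`. -/
theorem abs_iteratedDeriv_iterate_le (hd : Differentiable ℝ f) (hpos : ∀ x, 0 < deriv f x)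
    {s i : ℕ} (hu : ContDiff ℝ s (logDIter f i)) {x C C₀ w : ℝ} (hC1 : 1 ≤ C) (hC₀ : 1 ≤ C₀)
    (hw : 0 ≤ w) (hexp : Real.exp (logDIter f i x) ≤ C₀ * w)
    (ih : ∀ j, 1 ≤ j → j ≤ s → |iteratedDeriv j (logDIter f i) x| ≤ (C * w) ^ j)
    {m : ℕ} (hm1 : 1 ≤ m) (hm : m ≤ s) :
    |iteratedDeriv m f^[i] x| ≤ (s.factorial * C₀ * C * w) ^ m := by
  obtain ⟨m, rfl⟩ : ∃ m', m = m' + 1 := ⟨m - 1, by omega⟩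
  have hder : deriv f^[i] = fun y => Real.exp (logDIter f i y) :=
    funext fun y => (hasDerivAt_iterate_exp hd hpos i y).deriv
  have hfac : (1 : ℝ) ≤ s.factorial := by exact_mod_cast s.factorial_pos
  have hfac' : (m.factorial : ℝ) ≤ s.factorial := by
    exact_mod_cast Nat.factorial_le (by omega)
  have hC0 : 0 ≤ C := by linarith
  have hC₀0 : 0 ≤ C₀ := by linarith
  rw [iteratedDeriv_succ', hder]
  have h1 := abs_iteratedDeriv_exp_comp_le (n := m) (hu.of_le (by exact_mod_cast (by omega))) x
    (D := C * w) (fun j h1 hj => ih j h1 (by omega))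
  refine h1.trans ?_
  have hB : C * w ≤ s.factorial * C₀ * C * w := by
    have : 1 * C ≤ s.factorial * C₀ * C :=
      mul_le_mul_of_nonneg_right (one_le_mul_of_one_le_of_one_le hfac hC₀) hC0
    exact mul_le_mul_of_nonneg_right (by linarith) hw
  calc (m.factorial : ℝ) * Real.exp (logDIter f i x) * (C * w) ^ m
      ≤ s.factorial * (C₀ * w) * (s.factorial * C₀ * C * w) ^ m := by gcongr
    _ ≤ s.factorial * (C₀ * w) * C * (s.factorial * C₀ * C * w) ^ m := by
        refine mul_le_mul_of_nonneg_right ?_ (by positivity)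
        exact le_mul_of_one_le_right (by positivity) hC1
    _ = _ := by ring

theorem contDiff_schwarzianOne {r : ℕ} (hC : ContDiff ℝ (r + 3 : ℕ) f)
    (hpos : ∀ x, 0 < deriv f x) : ContDiff ℝ r (schwarzianOne f) := by
  have h := contDiff_logD (k := r + 2) hC hpos
  have h1 := contDiff_deriv h
  have h2 := contDiff_deriv h1
  exact h2.sub (((h1.of_le (by exact_mod_cast Nat.le_succ r)).pow 2).div_const 2)

/-- The inductive step for the derivatives of `log (f^l)'`: the second derivative is expressed
through the first one and the Schwarzian derivative. -/
theorem exists_abs_iteratedDeriv_succ_le (hf : Irrational f.translationNumber) {r s : ℕ}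
    (hs : s ≤ r) (hC : ContDiff ℝ (r + 3 : ℕ) f) (hpos : ∀ x, 0 < deriv f x) {C : ℝ} (hC1 : 1 ≤ C)
    (ih : ∀ i, 1 ≤ i → i ≤ s + 1 → ∀ (n l : ℕ) (x : ℝ), l ≤ 2 * q f.translationNumber (n + 1) →
      |iteratedDeriv i (logDIter f l) x| ≤ (C * scale f n x) ^ i) :
    ∃ C', 1 ≤ C' ∧ ∀ (n l : ℕ) (x : ℝ), l ≤ 2 * q f.translationNumber (n + 1) →
      |iteratedDeriv (s + 2) (logDIter f l) x| ≤ (C' * scale f n x) ^ (s + 2) := by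
  have hC3 : ContDiff ℝ 3 f := hC.of_le (by exact_mod_cast (by omega : 3 ≤ r + 3))
  have hC2 : ContDiff ℝ 2 f := hC3.of_le (by norm_num)
  have hd : Differentiable ℝ f := hC2.differentiable two_ne_zero
  obtain ⟨C₀, hC₀, hexp⟩ := exists_exp_logDIter_le_scale hf hC2 hpos
  obtain ⟨C₂, hC₂, hsum⟩ := exists_sum_exp_sq_le_scale hf hC2 hpos
  have hS : ContDiff ℝ s (schwarzianOne f) :=
    (contDiff_schwarzianOne hC hpos).of_le (by exact_mod_cast hs)
  have hSp : ∀ x, schwarzianOne f (x + 1) = schwarzianOne f x := fun x => by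
    have hp := deriv_add_one_of_periodic (logD_add_one f)
    simp only [schwarzianOne, hp, deriv_add_one_of_periodic hp]
  obtain ⟨K, hK0, hK⟩ : ∃ K, 0 < K ∧ ∀ j ≤ s, ∀ x, |iteratedDeriv j (schwarzianOne f) x| ≤ K := by
    have h1 : ∀ j, ∃ K, 0 < K ∧ (j ≤ s → ∀ x, |iteratedDeriv j (schwarzianOne f) x| ≤ K) := by
      intro j
      by_cases hj : j ≤ s
      · obtain ⟨K, hK0, hK⟩ := exists_abs_le_of_periodic
          (hS.continuous_iteratedDeriv j (by exact_mod_cast hj))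
          (iteratedDeriv_add_one_of_periodic hSp j)
        exact ⟨K, hK0, fun _ => hK⟩
      · exact ⟨1, one_pos, fun h => absurd h hj⟩
    choose K hK0 hK using h1
    refine ⟨∑ j ∈ Finset.range (s + 1), K j, Finset.sum_pos (fun j _ => hK0 j) (by simp),
      fun j hj x => (hK j hj x).trans ?_⟩
    exact Finset.single_le_sum (f := K) (fun i _ => (hK0 i).le)
      (Finset.mem_range.2 (by omega))
  have hu : ∀ l, ContDiff ℝ (r + 2 : ℕ) (logDIter f l) := contDiff_logDIter hC hpos
  set B : ℝ := s.factorial * C₀ * C with hB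
  have hB0 : 0 ≤ B := by positivity
  set E : ℝ := 2 ^ s * ((s.factorial * K) * s.factorial) * (B + 2 * C) ^ s * C₂ with hE
  have hE0 : 0 ≤ E := by positivity
  have hone : (1 : ℝ) ≤ 2 ^ s * C ^ (s + 2) :=
    one_le_mul_of_one_le_of_one_le (one_le_pow₀ one_le_two) (one_le_pow₀ hC1)
  refine ⟨2 ^ s * C ^ (s + 2) + E, by linarith, fun n l x hl => ?_⟩
  set w := scale f n x with hw
  have hw0 : 0 < w := scale_pos hf n x
  -- The derivatives of one term of the Schwarzian derivative of `f^l`.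
  have hterm : ∀ i < l, |iteratedDeriv s
      (fun y => schwarzianOne f (f^[i] y) * Real.exp (logDIter f i y) ^ 2) x| ≤
      2 ^ s * ((s.factorial * K) * (s.factorial * Real.exp (logDIter f i x) ^ 2)) *
        ((B + 2 * C) * w) ^ s := by
    intro i hi
    have hiQ : i ≤ 2 * q f.translationNumber (n + 1) := by omega
    have hus : ContDiff ℝ s (logDIter f i) := (hu i).of_le (by exact_mod_cast (by omega))
    have hfs : ContDiff ℝ s f^[i] :=
      (contDiff_iterate hC i).of_le (by exact_mod_cast (by omega))
    have hsq : (fun y => Real.exp (logDIter f i y) ^ 2) =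
        fun y => Real.exp (2 * logDIter f i y) :=
      funext fun y => by rw [← Real.exp_nat_mul]; norm_num
    have hsqx : Real.exp (logDIter f i x) ^ 2 = Real.exp (2 * logDIter f i x) := by
      rw [← Real.exp_nat_mul]; norm_num
    refine abs_iteratedDeriv_mul_le (hS.comp hfs) (hus.exp.pow 2) x (by positivity) ?_ ?_
    · intro m hm
      have hm' : (m.factorial : ℝ) ≤ s.factorial := by exact_mod_cast Nat.factorial_le hm
      have h1 := abs_iteratedDeriv_comp_le (n := m) (hS.of_le (by exact_mod_cast hm))
        (hfs.of_le (by exact_mod_cast hm)) x (C := K) (D := B * w)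
        (fun j hj => hK j (hj.trans hm) _)
        (fun j h1 hj => abs_iteratedDeriv_iterate_le hd hpos hus hC1 hC₀ hw0.le
          (hexp n i x hiQ) (fun j h1 hj => ih j h1 (by omega) n i x hiQ) h1 (by omega))
      refine h1.trans ?_
      gcongr
      linarith
    · intro m hm
      have hm' : (m.factorial : ℝ) ≤ s.factorial := by exact_mod_cast Nat.factorial_le hm
      have h1 := abs_iteratedDeriv_exp_comp_le (n := m) (h := fun y => 2 * logDIter f i y)
        (contDiff_const.mul (hus.of_le (by exact_mod_cast hm))) x (D := 2 * C * w) (by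
          intro j h1 hj
          rw [iteratedDeriv_const_mul_field, abs_mul, abs_two, mul_assoc 2 C, mul_pow 2]
          refine mul_le_mul ?_ (ih j h1 (by omega) n i x hiQ) (abs_nonneg _) (by positivity)
          exact le_self_pow₀ one_le_two (by omega))
      rw [hsq, hsqx]
      refine h1.trans ?_
      gcongr
      linarith
  have hsplit : deriv (deriv (logDIter f l)) = fun y =>
      deriv (logDIter f l) y * deriv (logDIter f l) y / 2 +
      ∑ i ∈ Finset.range l, schwarzianOne f (f^[i] y) * Real.exp (logDIter f i y) ^ 2 := by
    ext y
    rw [← schwarzian_eq_sum hC3 hpos, schwarzian]; ring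
  have hu' : ContDiff ℝ s (deriv (logDIter f l)) :=
    (contDiff_deriv (hu l)).of_le (by exact_mod_cast (by omega : s ≤ r + 1))
  have hterms : ∀ i ∈ Finset.range l, ContDiff ℝ s
      (fun y => schwarzianOne f (f^[i] y) * Real.exp (logDIter f i y) ^ 2) := fun i _ =>
    (hS.comp ((contDiff_iterate hC i).of_le (by exact_mod_cast (by omega)))).mul
      ((((hu i).of_le (by exact_mod_cast (by omega))).exp).pow 2)
  have hsq := abs_iteratedDeriv_mul_le (n := s) hu' hu' x (A := C * w) (B := C * w) (w := C * w)
    (by positivity)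
    (fun i hi => by
      rw [← iteratedDeriv_succ', ← pow_succ']; exact ih (i + 1) (by omega) (by omega) n l x hl)
    (fun i hi => by
      rw [← iteratedDeriv_succ', ← pow_succ']; exact ih (i + 1) (by omega) (by omega) n l x hl)
  have hsch : |iteratedDeriv s (fun y => ∑ i ∈ Finset.range l,
      schwarzianOne f (f^[i] y) * Real.exp (logDIter f i y) ^ 2) x| ≤ E * w ^ (s + 2) := by
    rw [iteratedDeriv_fun_sum fun i hi => (hterms i hi).contDiffAt]
    refine (Finset.abs_sum_le_sum_abs _ _).trans ?_
    calc _ ≤ ∑ i ∈ Finset.range l, 2 ^ s * ((s.factorial * K) * s.factorial) *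
          ((B + 2 * C) * w) ^ s * Real.exp (logDIter f i x) ^ 2 :=
          Finset.sum_le_sum fun i hi =>
            (hterm i (Finset.mem_range.1 hi)).trans (le_of_eq (by ring))
      _ ≤ 2 ^ s * ((s.factorial * K) * s.factorial) * ((B + 2 * C) * w) ^ s * (C₂ * w ^ 2) := by
          rw [← Finset.mul_sum]
          exact mul_le_mul_of_nonneg_left (hsum n l x hl) (by positivity)
      _ = E * w ^ (s + 2) := by rw [hE, mul_pow (B + 2 * C)]; ring
  rw [iteratedDeriv_succ', iteratedDeriv_succ', hsplit,
    iteratedDeriv_fun_add ((hu'.mul hu').div_const 2).contDiffAt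
      (ContDiff.sum hterms).contDiffAt, iteratedDeriv_div_const]
  refine (abs_add_le _ _).trans ?_
  rw [abs_div, abs_two]
  calc _ ≤ 2 ^ s * (C * w * (C * w)) * (C * w) ^ s + E * w ^ (s + 2) := by
        refine add_le_add ?_ hsch
        have := abs_nonneg (iteratedDeriv s
          (fun y => deriv (logDIter f l) y * deriv (logDIter f l) y) x)
        linarith
    _ = (2 ^ s * C ^ (s + 2) + E) * w ^ (s + 2) := by ring
    _ ≤ (2 ^ s * C ^ (s + 2) + E) ^ (s + 2) * w ^ (s + 2) := by
        refine mul_le_mul_of_nonneg_right ?_ (by positivity)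
        exact le_self_pow₀ (by linarith) (by omega)
    _ = _ := by rw [mul_pow]

/-- The derivatives of `log (f^l)'`, `l ≤ 2 q_{n+1}`, of order `i` are bounded by the `i`-th power
of the scale `M_n^{1/2} / β_n(x)`. -/
theorem exists_abs_iteratedDeriv_logDIter_le (hf : Irrational f.translationNumber) {r : ℕ}
    (hC : ContDiff ℝ (r + 3 : ℕ) f) (hpos : ∀ x, 0 < deriv f x) {s : ℕ} (hs : s ≤ r + 1) :
    ∃ C, 1 ≤ C ∧ ∀ i, 1 ≤ i → i ≤ s + 1 → ∀ (n l : ℕ) (x : ℝ),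
      l ≤ 2 * q f.translationNumber (n + 1) →
        |iteratedDeriv i (logDIter f l) x| ≤ (C * scale f n x) ^ i := by
  induction s with
  | zero =>
    have hC3 : ContDiff ℝ 3 f := hC.of_le (by exact_mod_cast (by omega : 3 ≤ r + 3))
    obtain ⟨C, hC0, h⟩ := exists_abs_deriv_logDIter_le_sqrt hf hC3 hpos
    refine ⟨C + 1, by linarith, fun i h1 hi n l x hl => ?_⟩
    obtain rfl : i = 1 := by omega
    rw [iteratedDeriv_one, pow_one, scale, ← mul_div_assoc, le_div_iff₀ (beta_pos hf n x)]
    exact (h n l x hl).trans (by linarith [Real.sqrt_nonneg (bigM f n)])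
  | succ s ihs =>
    obtain ⟨C, hC1, ih⟩ := ihs (by omega)
    obtain ⟨C', hC'1, h⟩ := exists_abs_iteratedDeriv_succ_le hf (by omega : s ≤ r) hC hpos hC1 ih
    refine ⟨max C C', hC1.trans (le_max_left _ _), fun i h1 hi n l x hl => ?_⟩
    have hw := (scale_pos hf n x).le
    rcases Nat.lt_or_ge i (s + 2) with h2 | h2
    · refine (ih i h1 (by omega) n l x hl).trans ?_
      gcongr
      exact le_max_left _ _
    · obtain rfl : i = s + 2 := by omega
      refine (h n l x hl).trans ?_
      gcongr
      exact le_max_right _ _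

/-- The loss of one power comes from the first derivative of `f^{q_{n+1}}`, which is bounded. -/
theorem exists_abs_iteratedDeriv_ret_le (hf : Irrational f.translationNumber) {r : ℕ}
    (hC : ContDiff ℝ (r + 3 : ℕ) f) (hpos : ∀ x, 0 < deriv f x) :
    ∃ C, 0 < C ∧ ∀ (n : ℕ) (x : ℝ),
      |iteratedDeriv (r + 3) (ret f (n + 1)) x| ≤ C * scale f n x ^ (r + 2) := by
  have hC2 : ContDiff ℝ 2 f := hC.of_le (by exact_mod_cast (by omega : 2 ≤ r + 3))
  obtain ⟨C, hC1, h⟩ := exists_abs_iteratedDeriv_logDIter_le hf hC hpos le_rfl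
  obtain ⟨D, hD0, hD⟩ := exists_abs_logDIter_q_le hf hC2 hpos
  refine ⟨(r + 2).factorial * Real.exp D * C ^ (r + 2), by positivity, fun n x => ?_⟩
  have hder : deriv (ret f (n + 1)) =
      fun y => Real.exp (logDIter f (q f.translationNumber (n + 1)) y) :=
    funext fun y => (hasDerivAt_ret (hC2.differentiable two_ne_zero) hpos (n + 1) y).deriv
  have hw := (scale_pos hf n x).le
  rw [iteratedDeriv_succ', hder]
  refine (abs_iteratedDeriv_exp_comp_le (contDiff_logDIter hC hpos _) x
    (fun i h1 hi => h i h1 hi n _ x (by omega))).trans ?_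
  rw [mul_pow, ← mul_assoc]
  gcongr
  exact (abs_le.1 (hD (n + 1) x)).2

/-! ### Interpolation -/

theorem abs_eval_basis_le {v : ℕ → ℝ} {d i : ℕ} {η ℓ y : ℝ} (hη : 0 < η) (hi : i ≤ d)
    (hgap : ∀ i ≤ d, ∀ j ≤ d, i ≠ j → η ≤ |v i - v j|) (hy : ∀ j ≤ d, |y - v j| ≤ ℓ) :
    |(Lagrange.basis (Finset.range (d + 1)) v i).eval y| ≤ (ℓ / η) ^ d := by
  have hmem : i ∈ Finset.range (d + 1) := Finset.mem_range.2 (by omega)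
  rw [Lagrange.basis, Polynomial.eval_prod, Finset.abs_prod]
  calc _ ≤ ∏ j ∈ (Finset.range (d + 1)).erase i, ℓ / η := by
        refine Finset.prod_le_prod (fun _ _ => abs_nonneg _) fun j hj => ?_
        obtain ⟨hji, hj⟩ := Finset.mem_erase.1 hj
        have hj : j ≤ d := by have := Finset.mem_range.1 hj; omega
        rw [Lagrange.basisDivisor, Polynomial.eval_mul, Polynomial.eval_C, Polynomial.eval_sub,
          Polynomial.eval_X, Polynomial.eval_C, ← div_eq_inv_mul, abs_div]
        exact div_le_div₀ ((abs_nonneg _).trans (hy j hj)) (hy j hj) hη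
          (hgap i hi j hj hji.symm)
    _ = (ℓ / η) ^ d := by
        rw [Finset.prod_const, Finset.card_erase_of_mem hmem, Finset.card_range,
          Nat.add_sub_cancel]

/-- A polynomial of degree at most `d` is controlled by its values at `d + 1` separated nodes. -/
theorem abs_eval_sub_le_of_nodes {v : ℕ → ℝ} {d : ℕ} {η ℓ y c e : ℝ} (hη : 0 < η)
    (hgap : ∀ i ≤ d, ∀ j ≤ d, i ≠ j → η ≤ |v i - v j|) (hy : ∀ j ≤ d, |y - v j| ≤ ℓ)
    {P : Polynomial ℝ} (hP : P ∈ Polynomial.degreeLT ℝ (d + 1))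
    (he : ∀ i ≤ d, |P.eval (v i) - c| ≤ e) :
    |P.eval y - c| ≤ (d + 1) * ((ℓ / η) ^ d * e) := by
  have hinj : Set.InjOn v (Finset.range (d + 1)) := by
    intro i hi j hj hij
    have hi : i ≤ d := by have := Finset.mem_range.1 (Finset.mem_coe.1 hi); omega
    have hj : j ≤ d := by have := Finset.mem_range.1 (Finset.mem_coe.1 hj); omega
    by_contra hne
    have := hgap i hi j hj hne
    rw [hij, sub_self, abs_zero] at this
    linarith
  have hQ : P - Polynomial.C c ∈ Polynomial.degreeLT ℝ (d + 1) := by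
    refine Submodule.sub_mem _ hP (Polynomial.mem_degreeLT.2 ?_)
    exact Polynomial.degree_C_le.trans_lt (by exact_mod_cast Nat.succ_pos d)
  have hdeg : (P - Polynomial.C c).degree < (Finset.range (d + 1)).card := by
    rw [Finset.card_range]; exact Polynomial.mem_degreeLT.1 hQ
  have h := congrArg (Polynomial.eval y) (Lagrange.eq_interpolate hinj hdeg)
  rw [Lagrange.interpolate_apply, Polynomial.eval_finsetSum] at h
  simp only [Polynomial.eval_sub, Polynomial.eval_C, Polynomial.eval_mul] at h
  rw [h]
  refine (Finset.abs_sum_le_sum_abs _ _).trans ?_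
  calc _ ≤ ∑ i ∈ Finset.range (d + 1), (ℓ / η) ^ d * e := by
        refine Finset.sum_le_sum fun i hi => ?_
        have hi : i ≤ d := by have := Finset.mem_range.1 hi; omega
        rw [abs_mul, mul_comm]
        exact mul_le_mul (abs_eval_basis_le hη hi hgap hy) (he i hi) (abs_nonneg _)
          ((abs_nonneg _).trans (abs_eval_basis_le hη hi hgap hy))
    _ = (d + 1) * ((ℓ / η) ^ d * e) := by
        rw [Finset.sum_const, Finset.card_range, nsmul_eq_mul]; push_cast; ring

/-- Control of a function by its values at `d + 1` separated nodes and by its derivative of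
order `d + 1`: both the function and its interpolation polynomial are compared with a Taylor
polynomial. -/
theorem abs_sub_le_of_nodes {φ : ℝ → ℝ} {d : ℕ} (hφ : ContDiff ℝ (d + 1 : ℕ) φ) {a b : ℝ}
    (hab : a < b) {v : ℕ → ℝ} {η c e K : ℝ} (hη : 0 < η)
    (hv : ∀ i ≤ d, v i ∈ Icc a b) (hgap : ∀ i ≤ d, ∀ j ≤ d, i ≠ j → η ≤ |v i - v j|)
    (he : ∀ i ≤ d, |φ (v i) - c| ≤ e)
    (hK : ∀ z ∈ Icc a b, |iteratedDeriv (d + 1) φ z| ≤ K) {y : ℝ} (hy : y ∈ Icc a b) :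
    |φ y - c| ≤ (d + 1) * (((b - a) / η) ^ d * (e + K * (b - a) ^ (d + 1))) +
      K * (b - a) ^ (d + 1) := by
  have hK0 : 0 ≤ K := (abs_nonneg _).trans (hK a (left_mem_Icc.2 hab.le))
  set P : Polynomial ℝ := ∑ j ∈ Finset.range (d + 1),
    Polynomial.C ((j.factorial : ℝ)⁻¹ * iteratedDerivWithin j φ (Icc a b) a) *
      (Polynomial.X - Polynomial.C a) ^ j with hPdef
  have hP : P ∈ Polynomial.degreeLT ℝ (d + 1) := by
    refine Submodule.sum_mem _ fun j hj => Polynomial.mem_degreeLT.2 ?_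
    have hj := Finset.mem_range.1 hj
    rw [← Polynomial.smul_eq_C_mul]
    refine (Polynomial.degree_smul_le _ _).trans_lt ?_
    rw [Polynomial.degree_pow, Polynomial.degree_X_sub_C, nsmul_one]
    exact_mod_cast hj
  have hPeval : ∀ z, P.eval z = taylorWithinEval φ d (Icc a b) a z := by
    intro z
    rw [taylor_within_apply, hPdef, Polynomial.eval_finsetSum]
    refine Finset.sum_congr rfl fun j _ => ?_
    simp only [Polynomial.eval_mul, Polynomial.eval_C, Polynomial.eval_pow, Polynomial.eval_sub,
      Polynomial.eval_X, smul_eq_mul]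
    ring
  have hrem : ∀ z ∈ Icc a b, |φ z - P.eval z| ≤ K * (b - a) ^ (d + 1) := by
    intro z hz
    rw [hPeval]
    have h1 := taylor_mean_remainder_bound (n := d) hab.le
      (by exact_mod_cast hφ.contDiffOn) hz (C := K) (fun w hw => by
        rw [iteratedDerivWithin_eq_iteratedDeriv (uniqueDiffOn_Icc hab) hφ.contDiffAt hw]
        exact hK w hw)
    refine h1.trans ?_
    have h2 : (z - a) ^ (d + 1) ≤ (b - a) ^ (d + 1) :=
      pow_le_pow_left₀ (by linarith [hz.1]) (by linarith [hz.2]) _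
    have h3 : (1 : ℝ) ≤ d.factorial := by exact_mod_cast d.factorial_pos
    have h4 : 0 ≤ (z - a) ^ (d + 1) := pow_nonneg (by linarith [hz.1]) _
    exact (div_le_self (by positivity) h3).trans (mul_le_mul_of_nonneg_left h2 hK0)
  have h1 := abs_eval_sub_le_of_nodes (y := y) (ℓ := b - a) (c := c)
    (e := e + K * (b - a) ^ (d + 1)) hη hgap
    (fun j hj => by
      have h1 := hv j hj
      rw [abs_le]; constructor <;> linarith [h1.1, h1.2, hy.1, hy.2]) hP
    (fun i hi => by
      have h1 := abs_sub_le (P.eval (v i)) (φ (v i)) c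
      have h2 := hrem _ (hv i hi)
      rw [abs_sub_comm] at h2
      linarith [he i hi])
  have h2 := hrem y hy
  have h3 := abs_sub_le (φ y) (P.eval y) c
  linarith

/-- The orbit `x, f^{q_n}(x), f^{2 q_n}(x), …` on the line. -/
noncomputable def node (f : CircleDeg1Lift) (n : ℕ) (x : ℝ) (i : ℕ) : ℝ := (ret f n)^[i] x

theorem node_zero (n : ℕ) (x : ℝ) : node f n x 0 = x := rfl

theorem node_succ (n : ℕ) (x : ℝ) (i : ℕ) : node f n x (i + 1) = ret f n (node f n x i) :=
  Function.iterate_succ_apply' _ _ _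

theorem node_strictMono (hf : Irrational f.translationNumber) (n : ℕ) (x : ℝ) :
    StrictMono fun i => (-1) ^ n * node f n x i :=
  strictMono_nat_of_lt_succ fun i => by
    rw [node_succ]; linarith [ret_sub_sign hf n (node f n x i)]

theorem node_mem_uIcc (hf : Irrational f.translationNumber) (n : ℕ) (x : ℝ) {i j : ℕ}
    (hij : i ≤ j) : node f n x i ∈ uIcc x (node f n x j) := by
  have h1 := (node_strictMono hf n x).monotone hij
  have h2 := (node_strictMono hf n x).monotone (Nat.zero_le i)
  simp only [node_zero] at h1 h2
  rw [mem_uIcc]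
  rcases neg_one_pow_eq_or ℝ n with hn | hn <;> rw [hn] at h1 h2
  · left; constructor <;> linarith
  · right; constructor <;> linarith

/-- On the first fundamental intervals of an orbit of `f^{q_n}`, the lengths `β_n` are
comparable. -/
theorem beta_node_comparable {n : ℕ} {B : ℝ} (hB1 : 1 ≤ B)
    (hf : Irrational f.translationNumber)
    (hB : ∀ x y : ℝ, y ∈ uIcc x (ret f n x) →
      beta f n y ≤ B * beta f n x ∧ beta f n x ≤ B * beta f n y) (x : ℝ) (m : ℕ) :
    (beta f n (node f n x m) ≤ B ^ m * beta f n x ∧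
      beta f n x ≤ B ^ m * beta f n (node f n x m)) ∧
    (∀ z ∈ uIcc x (node f n x m), beta f n x ≤ B ^ (m + 1) * beta f n z) ∧
    |node f n x m - x| ≤ m * B ^ m * beta f n x := by
  have hb := (beta_pos hf n x).le
  have hB0 : 0 ≤ B := by linarith
  induction m with
  | zero =>
    refine ⟨by simp [node_zero], fun z hz => ?_, by simp [node_zero]⟩
    rw [node_zero, uIcc_self, mem_singleton_iff] at hz
    rw [hz, zero_add, pow_one]
    exact le_mul_of_one_le_left hb hB1
  | succ m ih =>
    obtain ⟨⟨h1, h2⟩, h3, h4⟩ := ih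
    have hstep := hB (node f n x m)
    have hs := hB (node f n x m) (node f n x (m + 1)) (by rw [node_succ]; exact right_mem_uIcc)
    refine ⟨⟨?_, ?_⟩, fun z hz => ?_, ?_⟩
    · calc _ ≤ B * (B ^ m * beta f n x) := hs.1.trans (mul_le_mul_of_nonneg_left h1 hB0)
        _ = _ := by ring
    · calc _ ≤ B ^ m * (B * beta f n (node f n x (m + 1))) :=
            h2.trans (mul_le_mul_of_nonneg_left hs.2 (by positivity))
        _ = _ := by ring
    · rcases uIcc_subset_uIcc_union_uIcc (b := node f n x m) hz with hz | hz
      · refine (h3 z hz).trans ?_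
        exact mul_le_mul_of_nonneg_right (pow_le_pow_right₀ hB1 (by omega)) (beta_pos hf n z).le
      · rw [node_succ] at hz
        calc _ ≤ B ^ m * (B * beta f n z) :=
              h2.trans (mul_le_mul_of_nonneg_left (hstep z hz).2 (by positivity))
          _ ≤ B ^ (m + 1) * beta f n z := le_of_eq (by ring)
          _ ≤ _ := mul_le_mul_of_nonneg_right (pow_le_pow_right₀ hB1 (by omega))
              (beta_pos hf n z).le
    · have h5 : |node f n x (m + 1) - node f n x m| = beta f n (node f n x m) := by
        rw [node_succ, beta_eq_abs]
      have h6 := abs_sub_le (node f n x (m + 1)) (node f n x m) x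
      have h7 : B ^ m * beta f n x ≤ B ^ (m + 1) * beta f n x :=
        mul_le_mul_of_nonneg_right (pow_le_pow_right₀ hB1 (by omega)) hb
      push_cast
      have h8 := mul_le_mul_of_nonneg_left h7 (Nat.cast_nonneg (α := ℝ) m)
      nlinarith

/-- Since `f^{q_n}` is `O(M_n^{1/2})`-close to an isometry and commutes with `f^{q_{n+1}}`, the
displacement of `f^{q_{n+1}}` is almost constant along the orbits of `f^{q_n}`. -/
theorem abs_displacement_node_sub_le (hf : Irrational f.translationNumber)
    (hd : Differentiable ℝ f) (hpos : ∀ x, 0 < deriv f x) {n : ℕ} {A : ℝ} (hA0 : 0 ≤ A)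
    (hA : ∀ x, |Real.exp (logDIter f (q f.translationNumber n) x) - 1| ≤ A * √(bigM f n))
    (x : ℝ) (i : ℕ) :
    |(ret f (n + 1) (node f n x i) - node f n x i) - (ret f (n + 1) x - x)| ≤
      ((1 + A) ^ i - 1) * √(bigM f n) * |ret f (n + 1) x - x| := by
  induction i with
  | zero => simp [node_zero]
  | succ i ih =>
    set w := node f n x i with hw
    set Δ := |ret f (n + 1) x - x| with hΔ
    have hΔ0 : 0 ≤ Δ := abs_nonneg _
    have hM0 := Real.sqrt_nonneg (bigM f n)
    have hM1 : √(bigM f n) ≤ 1 := Real.sqrt_le_one.2 (bigM_le_one hf n)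
    obtain ⟨ξ, -, h⟩ := exists_mem_uIcc_sub_eq (hasDerivAt_ret hd hpos n) w (ret f (n + 1) w)
    have h1 : (ret f (n + 1) (node f n x (i + 1)) - node f n x (i + 1)) -
        (ret f (n + 1) w - w) =
        (Real.exp (logDIter f (q f.translationNumber n) ξ) - 1) * (ret f (n + 1) w - w) := by
      rw [node_succ, ← hw, ret_ret]; linear_combination h
    have hpow : 1 ≤ (1 + A) ^ i := one_le_pow₀ (by linarith)
    have h2 : |ret f (n + 1) w - w| ≤ (1 + A) ^ i * Δ := by
      have h3 := abs_sub_abs_le_abs_sub (ret f (n + 1) w - w) (ret f (n + 1) x - x)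
      have h4 : ((1 + A) ^ i - 1) * √(bigM f n) * Δ ≤ ((1 + A) ^ i - 1) * Δ :=
        mul_le_mul_of_nonneg_right (mul_le_of_le_one_right (by linarith) hM1) hΔ0
      linarith
    have h5 : |(ret f (n + 1) (node f n x (i + 1)) - node f n x (i + 1)) -
        (ret f (n + 1) w - w)| ≤ A * √(bigM f n) * ((1 + A) ^ i * Δ) := by
      rw [h1, abs_mul]
      exact mul_le_mul (hA ξ) h2 (abs_nonneg _) (by positivity)
    refine (abs_sub_le _ (ret f (n + 1) w - w) _).trans ((add_le_add h5 ih).trans (le_of_eq ?_))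
    ring

theorem contDiff_ret {k : ℕ} (hC : ContDiff ℝ k f) (n : ℕ) : ContDiff ℝ k (ret f n) :=
  (contDiff_iterate hC _).sub contDiff_const

/-- The main estimate: the variation of `β_{n+1}` on two consecutive intervals `I_n`. The
displacement of `f^{q_{n+1}}` is interpolated at the `r + 3` points `f^{i q_n}(x)`, `i ≤ r + 2`, whose
gaps are comparable to `β_n(x)`. -/
theorem exists_abs_beta_succ_sub_le (hf : Irrational f.translationNumber) {r : ℕ}
    (hC : ContDiff ℝ (r + 3 : ℕ) f) (hpos : ∀ x, 0 < deriv f x) :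
    ∃ C, 0 < C ∧ ∀ (n : ℕ) (x y : ℝ), y ∈ uIcc x (ret f n (ret f n x)) →
      |beta f (n + 1) y - beta f (n + 1) x| ≤
        C * (√(bigM f n) ^ (r + 2) * beta f n x + √(bigM f n) * beta f (n + 1) x) := by
  have hC3 : ContDiff ℝ 3 f := hC.of_le (by exact_mod_cast (by omega : 3 ≤ r + 3))
  have hC2 : ContDiff ℝ 2 f := hC3.of_le (by norm_num)
  have hd : Differentiable ℝ f := hC2.differentiable two_ne_zero
  obtain ⟨A, hA0, hA⟩ := exists_abs_exp_logDIter_q_sub_one_le hf hC3 hpos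
  obtain ⟨B, hB1, hB⟩ := exists_beta_comparable hf hC2 hpos
  obtain ⟨C, hC0, hCd⟩ := exists_abs_iteratedDeriv_ret_le hf hC hpos
  have hB0 : 0 < B := by linarith
  set W : ℝ := B ^ (r + 3) with hW
  have hW0 : 0 < W := by positivity
  have hWle : ∀ i ≤ r + 3, B ^ i ≤ W := fun i hi => pow_le_pow_right₀ hB1 hi
  set ℓ : ℝ := (r + 2 : ℕ) * W with hℓ
  have hℓ0 : 0 < ℓ := by positivity
  set G : ℝ := C * W ^ (r + 2) * ℓ ^ (r + 3) with hG
  have hG0 : 0 < G := by positivity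
  set H : ℝ := (1 + A) ^ (r + 2) with hH
  have hH0 : 0 < H := by positivity
  set R : ℝ := ((r + 2 : ℕ) + 1) * (ℓ * W) ^ (r + 2) with hR
  have hR0 : 0 < R := by positivity
  refine ⟨R * H + (R * G + G), by positivity, fun n x y hy => ?_⟩
  have hb := beta_pos hf n x
  have hb1 := beta_pos hf (n + 1) x
  have hM0 := Real.sqrt_nonneg (bigM f n)
  have hcomp := fun m => beta_node_comparable hB1 hf (hB n) x m
  set v := node f n x with hv
  set b := v (r + 2) with hbdef
  have hne : x ≠ b := by
    intro h
    have := (node_strictMono hf n x) (show 0 < r + 2 by omega)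
    simp only [node_zero, ← hv, ← hbdef, ← h] at this
    exact lt_irrefl _ this
  have hlen : max x b - min x b ≤ ℓ * beta f n x := by
    rw [max_sub_min_eq_abs]
    refine (hcomp (r + 2)).2.2.trans ?_
    rw [hℓ]
    gcongr
    exact hWle _ (by omega)
  have hlen0 : 0 ≤ max x b - min x b := by rw [max_sub_min_eq_abs]; positivity
  set φ : ℝ → ℝ := fun z => ret f (n + 1) z - z with hφ
  have hφC : ContDiff ℝ (r + 3 : ℕ) φ := (contDiff_ret hC (n + 1)).sub contDiff_id
  have hφd : iteratedDeriv (r + 3) φ = iteratedDeriv (r + 3) (ret f (n + 1)) := by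
    have h1 : deriv φ = fun z => deriv (ret f (n + 1)) z - 1 := funext fun z =>
      ((hasDerivAt_ret hd hpos (n + 1) z).differentiableAt.hasDerivAt.sub (hasDerivAt_id z)).deriv
    have h2 : deriv (deriv φ) = deriv (deriv (ret f (n + 1))) := by
      rw [h1]; exact funext fun z => deriv_sub_const 1
    rw [iteratedDeriv_succ' (n := r + 2) (f := φ), iteratedDeriv_succ' (n := r + 1) (f := deriv φ),
      iteratedDeriv_succ' (n := r + 2) (f := ret f (n + 1)),
      iteratedDeriv_succ' (n := r + 1) (f := deriv (ret f (n + 1))), h2]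
  have hβφ : ∀ z w, |beta f (n + 1) z - beta f (n + 1) w| = |φ z - φ w| := fun z w => by
    rw [beta_eq_mul hf, beta_eq_mul hf, ← mul_sub, abs_mul, abs_pow]; simp [hφ]
  have hφx : |φ x| = beta f (n + 1) x := (beta_eq_abs f (n + 1) x).symm
  have hmain := abs_sub_le_of_nodes (d := r + 2) hφC (a := min x b) (b := max x b)
    (min_lt_max.2 hne) (v := v) (η := beta f n x / W) (c := φ x)
    (e := H * √(bigM f n) * beta f (n + 1) x)
    (K := C * W ^ (r + 2) * √(bigM f n) ^ (r + 2) / beta f n x ^ (r + 2)) (by positivity)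
    (fun i hi => node_mem_uIcc hf n x hi)
    (by
      have hlt : ∀ i ≤ r + 2, ∀ j, i < j → beta f n x / W ≤ |v i - v j| := by
        intro i hi j hij
        have h1 := (node_strictMono hf n x).monotone (Nat.succ_le_of_lt hij)
        have h2 := (hcomp i).1.2.trans (mul_le_mul_of_nonneg_right (hWle i (by omega))
          (beta_pos hf n _).le)
        rw [Nat.succ_eq_add_one, node_succ] at h1
        have h3 := beta_eq_mul hf n (v i)
        have h4 : |v i - v j| = |(-1) ^ n * (v j - v i)| := by
          rw [abs_mul, abs_pow, abs_neg, abs_one, one_pow, one_mul, abs_sub_comm]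
        rw [h4, div_le_iff₀ hW0]
        have h5 : beta f n (v i) ≤ |(-1) ^ n * (v j - v i)| := by
          refine le_trans ?_ (le_abs_self _)
          rw [h3]; linarith
        calc _ ≤ W * beta f n (v i) := h2
          _ ≤ _ := by rw [mul_comm]; gcongr
      intro i hi j hj hij
      rcases lt_or_gt_of_ne hij with h | h
      · exact hlt i hi j h
      · rw [abs_sub_comm]; exact hlt j hj i h)
    (fun i hi => by
      refine (abs_displacement_node_sub_le hf hd hpos hA0.le (hA n) x i).trans ?_
      rw [← beta_eq_abs]
      have : (1 + A) ^ i ≤ H := pow_le_pow_right₀ (by linarith) hi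
      gcongr
      linarith)
    (fun z hz => by
      rw [hφd]
      refine (hCd n z).trans ?_
      have hz' := (hcomp (r + 2)).2.1 z hz
      have hbz := beta_pos hf n z
      have h1 : scale f n z ≤ W * √(bigM f n) / beta f n x := by
        rw [scale, div_le_div_iff₀ hbz hb]
        have := mul_le_mul_of_nonneg_left hz' hM0
        linarith
      calc _ ≤ C * (W * √(bigM f n) / beta f n x) ^ (r + 2) := by
            gcongr
            exact (scale_pos hf n z).le
        _ = _ := by rw [div_pow, mul_pow, ← mul_div_assoc, ← mul_assoc])
    (y := y) (by
      have h2 : ret f n (ret f n x) ∈ uIcc x b := node_mem_uIcc hf n x (by omega : 2 ≤ r + 2)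
      exact uIcc_subset_uIcc_left h2 hy)
  have hK : C * W ^ (r + 2) * √(bigM f n) ^ (r + 2) / beta f n x ^ (r + 2) *
      (max x b - min x b) ^ (r + 2 + 1) ≤ G * (√(bigM f n) ^ (r + 2) * beta f n x) := by
    calc _ ≤ C * W ^ (r + 2) * √(bigM f n) ^ (r + 2) / beta f n x ^ (r + 2) *
          (ℓ * beta f n x) ^ (r + 2 + 1) := by gcongr
      _ = _ := by rw [hG, mul_pow ℓ]; field_simp; ring
  have hρ : ((max x b - min x b) / (beta f n x / W)) ^ (r + 2) ≤ (ℓ * W) ^ (r + 2) := by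
    refine pow_le_pow_left₀ (by positivity) ?_ _
    rw [div_div_eq_mul_div, div_le_iff₀ hb]
    calc _ ≤ ℓ * beta f n x * W := by gcongr
      _ = _ := by ring
  rw [hβφ]
  refine hmain.trans ?_
  have h9 : ((r + 2 : ℕ) + 1 : ℝ) * (((max x b - min x b) / (beta f n x / W)) ^ (r + 2) *
      (H * √(bigM f n) * beta f (n + 1) x +
        C * W ^ (r + 2) * √(bigM f n) ^ (r + 2) / beta f n x ^ (r + 2) *
          (max x b - min x b) ^ (r + 2 + 1))) ≤
      R * (H * √(bigM f n) * beta f (n + 1) x + G * (√(bigM f n) ^ (r + 2) * beta f n x)) := by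
    rw [hR, mul_assoc _ ((ℓ * W) ^ (r + 2))]
    gcongr
  refine (add_le_add h9 hK).trans ?_
  have p1 : 0 ≤ √(bigM f n) ^ (r + 2) * beta f n x := by positivity
  have p2 : 0 ≤ √(bigM f n) * beta f (n + 1) x := by positivity
  have p3 : 0 ≤ R * H * (√(bigM f n) ^ (r + 2) * beta f n x) := by positivity
  have p4 : 0 ≤ (R * G + G) * (√(bigM f n) * beta f (n + 1) x) := by positivity
  linarith

/-! ### The semiconjugacy from the rotation and the mean value identity -/

/-- First mean value theorem for the integral of `g ∘ K` with `g` continuous and `K` monotone,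
possibly discontinuous. -/
theorem exists_integral_comp_eq_mul {g K : ℝ → ℝ} (hg : Continuous g) (hK : Monotone K) {a b : ℝ}
    (hi : IntervalIntegrable (fun s => g (K s)) volume a b) :
    ∃ y ∈ uIcc (K a) (K b), ∫ s in a..b, g (K s) = (b - a) * g y := by
  wlog hab : a ≤ b generalizing a b
  · obtain ⟨y, hy, h⟩ := this hi.symm (le_of_not_ge hab)
    refine ⟨y, by rwa [uIcc_comm], ?_⟩
    rw [intervalIntegral.integral_symm, h]; ring
  rcases hab.eq_or_lt with rfl | hlt
  · exact ⟨K a, left_mem_uIcc, by simp⟩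
  have hne : (uIcc (K a) (K b)).Nonempty := nonempty_uIcc
  obtain ⟨y₀, hy₀, hmin⟩ := isCompact_uIcc.exists_isMinOn hne hg.continuousOn
  obtain ⟨y₁, hy₁, hmax⟩ := isCompact_uIcc.exists_isMaxOn hne hg.continuousOn
  have hmem : ∀ s ∈ Icc a b, K s ∈ uIcc (K a) (K b) := fun s hs =>
    Icc_subset_uIcc ⟨hK hs.1, hK hs.2⟩
  have h0 : (b - a) * g y₀ ≤ ∫ s in a..b, g (K s) := by
    rw [← smul_eq_mul, ← intervalIntegral.integral_const]
    exact intervalIntegral.integral_mono_on hab intervalIntegrable_const hi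
      fun s hs => hmin (hmem s hs)
  have h1 : ∫ s in a..b, g (K s) ≤ (b - a) * g y₁ := by
    rw [← smul_eq_mul, ← intervalIntegral.integral_const]
    exact intervalIntegral.integral_mono_on hab hi intervalIntegrable_const
      fun s hs => hmax (hmem s hs)
  have hba : 0 < b - a := by linarith
  obtain ⟨y, hy, hgy⟩ := intermediate_value_uIcc hg.continuousOn (a := y₀) (b := y₁)
    (show (∫ s in a..b, g (K s)) / (b - a) ∈ uIcc (g y₀) (g y₁) from Icc_subset_uIcc
      ⟨by rw [le_div_iff₀ hba]; linarith, by rw [div_le_iff₀ hba]; linarith⟩)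
  refine ⟨y, uIcc_subset_uIcc hy₀ hy₁ hy, ?_⟩
  rw [hgy, mul_div_cancel₀ _ hba.ne']

/-- Fubini for increments: both sides are the second difference of a primitive of `K`. -/
theorem integral_increment_comm {K : ℝ → ℝ} (hK : Monotone K) (t δ ε : ℝ) :
    ∫ s in t..t + δ, (K (s + ε) - K s) = ∫ s in t..t + ε, (K (s + δ) - K s) := by
  have hi : ∀ a b, IntervalIntegrable K volume a b := fun a b => hK.intervalIntegrable
  have hs : ∀ c a b, IntervalIntegrable (fun s => K (s + c)) volume a b := fun c a b =>
    Monotone.intervalIntegrable fun _ _ h => hK (by linarith)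
  rw [intervalIntegral.integral_sub (hs _ _ _) (hi _ _),
    intervalIntegral.integral_sub (hs _ _ _) (hi _ _),
    intervalIntegral.integral_comp_add_right, intervalIntegral.integral_comp_add_right]
  have h1 := intervalIntegral.integral_add_adjacent_intervals (hi t (t + ε)) (hi (t + ε) (t + δ + ε))
  have h2 := intervalIntegral.integral_add_adjacent_intervals (hi t (t + δ)) (hi (t + δ) (t + δ + ε))
  rw [show t + ε + δ = t + δ + ε by ring]
  linarith

/-- A lift with rotation number `α` is semiconjugate to the translation by `α`. -/
theorem exists_semiconj_translation (hu : IsUnit f) :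
    ∃ K : CircleDeg1Lift, ∀ t, K (t + f.translationNumber) = f (K t) := by
  obtain ⟨K, hK⟩ := CircleDeg1Lift.semiconj_of_isUnit_of_translationNumber_eq
    (Units.isUnit (CircleDeg1Lift.translate (Multiplicative.ofAdd f.translationNumber))) hu
    (CircleDeg1Lift.translationNumber_translate _)
  refine ⟨K, fun t => ?_⟩
  rw [← hK t, CircleDeg1Lift.translate_apply, add_comm]

theorem semiconj_ret {K : CircleDeg1Lift} (hK : ∀ t, K (t + f.translationNumber) = f (K t))
    (n : ℕ) (t : ℝ) : K (t + delta f.translationNumber n) = ret f n (K t) := by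
  have h : ∀ i : ℕ, K (t + i * f.translationNumber) = f^[i] (K t) := by
    intro i
    induction i with
    | zero => simp
    | succ i ih =>
      rw [Function.iterate_succ_apply', ← ih, ← hK]
      congr 1; push_cast; ring
  rw [ret, ← h, delta, ← CircleDeg1Lift.map_sub_int]
  congr 1; ring

theorem ret_monotone (f : CircleDeg1Lift) (n : ℕ) : Monotone (ret f n) := fun _ _ h =>
  sub_le_sub_right (f.monotone.iterate _ h) _

/-- The image of the semiconjugacy may a priori omit `x`, but it meets the interval between `x` and
`f^{q_n}(x)`. -/
theorem exists_semiconj_mem_uIcc {K : CircleDeg1Lift} (hf : Irrational f.translationNumber)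
    (hK : ∀ t, K (t + f.translationNumber) = f (K t)) (n : ℕ) (x : ℝ) :
    ∃ t, K t ∈ uIcc x (ret f n x) := by
  set S : Set ℝ := {t | K t ≤ x} with hS
  have hne : S.Nonempty := by
    refine ⟨0 + ⌊x - K 0⌋, ?_⟩
    rw [hS, mem_ofPred_eq, CircleDeg1Lift.map_add_int]
    linarith [Int.floor_le (x - K 0)]
  have hbdd : BddAbove S := by
    refine ⟨0 + (⌊x - K 0⌋ + 1 : ℤ), fun t ht => ?_⟩
    by_contra! hlt
    have h := K.monotone hlt.le
    rw [CircleDeg1Lift.map_add_int] at h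
    push_cast at h
    have ht : K t ≤ x := ht
    linarith [Int.lt_floor_add_one (x - K 0)]
  set t₀ := sSup S
  have hlo : ∀ t < t₀, K t ≤ x := fun t ht => by
    obtain ⟨s, hs, hts⟩ := exists_lt_of_lt_csSup hne ht
    exact (K.monotone hts.le).trans hs
  have hhi : ∀ t, t₀ < t → x ≤ K t := fun t ht => by
    by_contra! h
    exact absurd (le_csSup hbdd (show t ∈ S from h.le)) (not_le.2 ht)
  set δ := delta f.translationNumber n with hδ
  have hδ0 : δ ≠ 0 := by
    have := delta_sign n hf
    intro h
    rw [← hδ, h, mul_zero] at this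
    exact lt_irrefl _ this
  have h1 : K (t₀ + δ / 2) = ret f n (K (t₀ - δ / 2)) := by
    rw [← semiconj_ret hK]; congr 1; ring
  refine ⟨t₀ + δ / 2, mem_uIcc.2 ?_⟩
  rcases hδ0.lt_or_gt with h | h
  · right
    refine ⟨?_, hlo _ (by linarith)⟩
    rw [h1]
    exact ret_monotone f n (hhi _ (by linarith))
  · left
    refine ⟨hhi _ (by linarith), ?_⟩
    rw [h1]
    exact ret_monotone f n (hlo _ (by linarith))

/-- The mean value of `β_{n+1}` over `I_n` and that of `β_n` over `I_{n+1}`, both with respect to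
the invariant measure, are in the ratio `α_{n+1} / α_n`. -/
theorem exists_alphaSeq_mul_beta_eq (hf : Irrational f.translationNumber) (hu : IsUnit f)
    (hd : Differentiable ℝ f) {n : ℕ} {B : ℝ} (hB0 : 0 ≤ B)
    (hB : ∀ x y : ℝ, y ∈ uIcc x (ret f n x) →
      beta f n y ≤ B * beta f n x ∧ beta f n x ≤ B * beta f n y) (x : ℝ) :
    ∃ y ∈ uIcc x (ret f n (ret f n x)), ∃ z,
      alphaSeq f.translationNumber n * beta f (n + 1) y =
        alphaSeq f.translationNumber (n + 1) * beta f n z ∧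
      beta f n x ≤ B ^ 3 * beta f n z := by
  obtain ⟨K, hK⟩ := exists_semiconj_translation hu
  obtain ⟨t, ht⟩ := exists_semiconj_mem_uIcc hf hK n x
  set δ := delta f.translationNumber n with hδ
  set ε := delta f.translationNumber (n + 1) with hε
  have hret : ∀ m, Continuous fun x => ret f m x - x := fun m =>
    ((hd.continuous.iterate _).sub continuous_const).sub continuous_id
  have hint : ∀ m a b, IntervalIntegrable (fun s => ret f m (K s) - K s) volume a b := by
    intro m a b
    refine (Monotone.intervalIntegrable fun s s' h => ?_).sub K.monotone.intervalIntegrable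
    exact ret_monotone f m (K.monotone h)
  obtain ⟨y, hy, h1⟩ := exists_integral_comp_eq_mul (hret (n + 1)) K.monotone
    (hint (n + 1) t (t + δ))
  obtain ⟨z, hz, h2⟩ := exists_integral_comp_eq_mul (hret n) K.monotone (hint n t (t + ε))
  have h3 := integral_increment_comm K.monotone t δ ε
  simp only [hδ, hε, semiconj_ret hK] at h1 h2 h3
  rw [h1, h2, ← hδ, ← hε, add_sub_cancel_left, add_sub_cancel_left] at h3
  rw [semiconj_ret hK] at hy hz
  set w := K t
  have hxw := hB x w ht
  refine ⟨y, ?_, z, ?_, ?_⟩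
  · have m1 := ret_sub_sign hf n x
    have m2 := ret_sub_sign hf n (ret f n x)
    have m3 := ret_sub_sign hf n w
    have hmono := ret_monotone f n
    rw [mem_uIcc] at ht hy ⊢
    rcases neg_one_pow_eq_or ℝ n with hn | hn <;> rw [hn] at m1 m2 m3
    · left
      rcases ht with ht | ht <;> rcases hy with hy | hy <;>
        constructor <;> linarith [hmono ht.1, hmono ht.2]
    · right
      rcases ht with ht | ht <;> rcases hy with hy | hy <;>
        constructor <;> linarith [hmono ht.1, hmono ht.2]
  · rw [alphaSeq_eq_abs_delta, alphaSeq_eq_abs_delta, beta_eq_abs, beta_eq_abs, ← abs_mul,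
      ← abs_mul, h3]
  · have hw : w ∈ uIcc (ret f (n + 1) w) (ret f n (ret f (n + 1) w)) := by
      have h4 := abs_delta_succ_lt hf n
      have s0 := delta_sign n hf
      have s1 := delta_sign (n + 1) hf
      have hwe : ret f (n + 1) w = K (t + ε) := (semiconj_ret hK (n + 1) t).symm
      rw [hwe, ← semiconj_ret hK]
      refine K.monotone.mapsTo_uIcc ?_
      rw [← hδ, ← hε] at *
      rw [pow_succ] at s1
      rw [mem_uIcc]
      rcases neg_one_pow_eq_or ℝ n with hn | hn <;> rw [hn] at s0 s1
      · left
        rw [abs_of_neg (a := ε) (by linarith), abs_of_pos (a := δ) (by linarith)] at h4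
        constructor <;> linarith
      · right
        rw [abs_of_pos (a := ε) (by linarith), abs_of_neg (a := δ) (by linarith)] at h4
        constructor <;> linarith
    have hz' := uIcc_subset_uIcc hw left_mem_uIcc hz
    calc beta f n x ≤ B * (B * (B * beta f n z)) := by
          refine hxw.2.trans (mul_le_mul_of_nonneg_left ?_ hB0)
          refine (hB _ _ hw).1.trans (mul_le_mul_of_nonneg_left ?_ hB0)
          exact (hB _ _ hz').2
      _ = _ := by ring

/-! ### The two renormalization inequalities -/

/-- The inequalities of the theorem without denominators, for `k = r + 3`: the powers of `M_n` are
`M_n^{(k-1)/2} = √M_n ^ (r + 2)`. For the second one, where the factor on the left is negative there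
is nothing to prove; otherwise `m_n ≤ β_n(z)` may be used at the point `z` of the mean value
identity. -/
theorem exists_bigM_succ_le_and_le_smallM_succ (hf : Irrational f.translationNumber)
    (hu : IsUnit f) {r : ℕ} (hC : ContDiff ℝ (r + 3 : ℕ) f) (hpos : ∀ x, 0 < deriv f x) :
    ∃ C, 0 < C ∧ ∀ n,
      bigM f (n + 1) * (1 - C * √(bigM f n)) ≤ bigM f n *
        (alphaSeq f.translationNumber (n + 1) / alphaSeq f.translationNumber n +
          C * √(bigM f n) ^ (r + 2)) ∧
      smallM f n *
        (alphaSeq f.translationNumber (n + 1) / alphaSeq f.translationNumber n -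
          C * √(bigM f n) ^ (r + 2)) ≤ smallM f (n + 1) * (1 + C * √(bigM f n)) := by
  have hC2 : ContDiff ℝ 2 f := hC.of_le (by exact_mod_cast (by omega : 2 ≤ r + 3))
  have hd : Differentiable ℝ f := hC2.differentiable two_ne_zero
  obtain ⟨B, hB1, hB⟩ := exists_beta_comparable hf hC2 hpos
  obtain ⟨C, hC0, hvar⟩ := exists_abs_beta_succ_sub_le hf hC hpos
  have hB0 : 0 < B := by linarith
  have hCB : C ≤ C * B ^ 3 := le_mul_of_one_le_right hC0.le (one_le_pow₀ hB1)
  have hCB0 : 0 < C * B ^ 3 := by positivity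
  refine ⟨C * B ^ 3, hCB0, fun n => ?_⟩
  set a := alphaSeq f.translationNumber n
  set a' := alphaSeq f.translationNumber (n + 1)
  have ha : 0 < a := by
    rw [show a = _ from alphaSeq_eq_abs_delta _ _]; exact abs_delta_pos hf n
  have ha' : 0 ≤ a' := abs_nonneg _
  set s := √(bigM f n)
  have hs : 0 ≤ s := Real.sqrt_nonneg _
  have hratio : 0 ≤ a' / a := by positivity
  -- At a given point, compare with a point where `β_{n+1}` takes its mean value.
  have key : ∀ x, ∃ y z, beta f (n + 1) y = a' / a * beta f n z ∧
      beta f n x ≤ B ^ 3 * beta f n z ∧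
      |beta f (n + 1) y - beta f (n + 1) x| ≤
        C * (s ^ (r + 2) * beta f n x + s * beta f (n + 1) x) := by
    intro x
    obtain ⟨y, hy, z, h1, h2⟩ := exists_alphaSeq_mul_beta_eq hf hu hd hB0.le (hB n) x
    refine ⟨y, z, ?_, h2, hvar n x y hy⟩
    rw [div_mul_eq_mul_div, eq_div_iff ha.ne', mul_comm, h1]
  constructor
  · obtain ⟨x, hx⟩ := exists_bigM_eq hf hd hpos (n + 1)
    obtain ⟨y, z, h1, -, h3⟩ := key x
    rw [hx]
    have h4 := (abs_le.1 h3).1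
    have h5 : a' / a * beta f n z ≤ a' / a * bigM f n :=
      mul_le_mul_of_nonneg_left (beta_le_bigM hf n z) hratio
    have h6 : C * (s ^ (r + 2) * beta f n x) ≤ C * B ^ 3 * (s ^ (r + 2) * bigM f n) := by
      have := (beta_pos hf n x).le
      gcongr
      exact beta_le_bigM hf n x
    have h7 : C * (s * beta f (n + 1) x) ≤ C * B ^ 3 * (s * beta f (n + 1) x) :=
      mul_le_mul_of_nonneg_right hCB (mul_nonneg hs (beta_pos hf _ _).le)
    linarith
  · obtain ⟨x, hx⟩ := exists_smallM_eq hf hd hpos (n + 1)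
    obtain ⟨x', hx'⟩ := exists_smallM_eq hf hd hpos n
    obtain ⟨y, z, h1, h2, h3⟩ := key x
    have hm : 0 < smallM f n := hx' ▸ beta_pos hf n x'
    have hb := beta_pos hf (n + 1) x
    rw [hx]
    have h4 := (abs_le.1 h3).2
    have h6 : C * (s ^ (r + 2) * beta f n x) ≤ C * (s ^ (r + 2) * (B ^ 3 * beta f n z)) := by
      gcongr
    have h7 : C * (s * beta f (n + 1) x) ≤ C * B ^ 3 * (s * beta f (n + 1) x) :=
      mul_le_mul_of_nonneg_right hCB (mul_nonneg hs hb.le)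
    have h8 : beta f n z * (a' / a - C * B ^ 3 * s ^ (r + 2)) ≤
        beta f (n + 1) x * (1 + C * B ^ 3 * s) := by linarith
    rcases le_total 0 (a' / a - C * B ^ 3 * s ^ (r + 2)) with h | h
    · exact (mul_le_mul_of_nonneg_right (smallM_le_beta n z) h).trans h8
    · exact (mul_nonpos_of_nonneg_of_nonpos hm.le h).trans (by positivity)

theorem deriv_pos_of_differentiable_units (F : CircleDeg1Liftˣ)
    (hF : Differentiable ℝ (F : CircleDeg1Lift))
    (hFinv : Differentiable ℝ (F⁻¹ : CircleDeg1Liftˣ)) (x : ℝ) :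
    0 < deriv (F : CircleDeg1Lift) x := by
  refine lt_of_le_of_ne (F : CircleDeg1Lift).monotone.deriv_nonneg fun h => ?_
  have h1 := ((hFinv _).hasDerivAt).comp x (hF x).hasDerivAt
  have h2 : (((F⁻¹ : CircleDeg1Liftˣ) : CircleDeg1Lift) ∘ (F : CircleDeg1Lift)) = id :=
    funext fun y => CircleDeg1Lift.units_inv_apply_apply F y
  rw [h2, ← h, mul_zero] at h1
  exact zero_ne_one (h1.unique (hasDerivAt_id x))

end CircleDynamics

theorem mainTheorem2 (k : ℕ) (hk : 3 ≤ k) (F : CircleDeg1Liftˣ)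
    (hF : ContDiff ℝ (k : WithTop ℕ∞) (F : CircleDeg1Lift))
    (hFinv : ContDiff ℝ (k : WithTop ℕ∞) (F⁻¹ : CircleDeg1Liftˣ))
    (hirr : Irrational (F : CircleDeg1Lift).translationNumber) :
    ∃ C : ℝ, 0 < C ∧
      (∀ᶠ n : ℕ in atTop, C * CircleDynamics.bigM F n ^ (1 / 2 : ℝ) < 1) ∧
      (∀ n : ℕ, C * CircleDynamics.bigM F n ^ (1 / 2 : ℝ) < 1 →
        CircleDynamics.bigM F (n + 1) ≤
          CircleDynamics.bigM F n *
            ((CircleDynamics.alphaSeq (F : CircleDeg1Lift).translationNumber (n + 1) /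
                CircleDynamics.alphaSeq (F : CircleDeg1Lift).translationNumber n +
              C * CircleDynamics.bigM F n ^ (((k : ℝ) - 1) / 2)) /
            (1 - C * CircleDynamics.bigM F n ^ (1 / 2 : ℝ)))) ∧
      (∀ n : ℕ,
        CircleDynamics.smallM F n *
            ((CircleDynamics.alphaSeq (F : CircleDeg1Lift).translationNumber (n + 1) /
                CircleDynamics.alphaSeq (F : CircleDeg1Lift).translationNumber n -
              C * CircleDynamics.bigM F n ^ (((k : ℝ) - 1) / 2)) /
            (1 + C * CircleDynamics.bigM F n ^ (1 / 2 : ℝ))) ≤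
          CircleDynamics.smallM F (n + 1)) := by
  obtain ⟨r, rfl⟩ := Nat.exists_eq_add_of_le' hk
  have hk0 : ((r + 3 : ℕ) : WithTop ℕ∞) ≠ 0 := by exact_mod_cast (by omega : r + 3 ≠ 0)
  have hpos := CircleDynamics.deriv_pos_of_differentiable_units F (hF.differentiable hk0)
    (hFinv.differentiable hk0)
  obtain ⟨C, hC0, hC⟩ := CircleDynamics.exists_bigM_succ_le_and_le_smallM_succ hirr F.isUnit hF hpos
  have hM : ∀ n, 0 < CircleDynamics.bigM F n := CircleDynamics.bigM_pos hirr
  have h1 : ∀ n, CircleDynamics.bigM F n ^ (1 / 2 : ℝ) = √(CircleDynamics.bigM F n) := fun n =>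
    (Real.sqrt_eq_rpow _).symm
  have h2 : ∀ n, CircleDynamics.bigM F n ^ ((((r + 3 : ℕ) : ℝ) - 1) / 2) =
      √(CircleDynamics.bigM F n) ^ (r + 2) := fun n => by
    rw [Real.sqrt_eq_rpow, ← Real.rpow_natCast, ← Real.rpow_mul (hM n).le]
    congr 1; push_cast; ring
  simp only [h1, h2]
  refine ⟨C, hC0, ?_, fun n hn => ?_, fun n => ?_⟩
  · have hlim := (CircleDynamics.tendsto_bigM hirr
      (hF.of_le (by exact_mod_cast (by omega : 2 ≤ r + 3))) hpos).sqrt.const_mul C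
    rw [Real.sqrt_zero, mul_zero] at hlim
    exact hlim.eventually_lt_const one_pos
  · rw [← mul_div_assoc, le_div_iff₀ (by linarith)]
    exact (hC n).1
  · rw [← mul_div_assoc, div_le_iff₀ (by positivity)]
    exact (hC n).2
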